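/- Let $k$ be a perfect field, let $R$ be a smooth $k$-algebra (of finite presentation), let $f \in R$ be a nonzerodivisor, and let $D = V(f) = \operatorname{Spec} \mathcal{O}_D$ with $\mathcal{O}_D = R/(f)$. Assume that $D$ is normal (all local rings of $D$ are normal domains) and of pure dimension $d$ (the local ring of $D$ at every closed point has dimension $d$). Let $\operatorname{Sing}(D)$ be the set of points of $D$ whose local ring is not regular, let $\operatorname{codim}_D \operatorname{Sing}(D)$ be the infimum of $\dim \mathcal{O}_{D,x}$ over $x \in \operatorname{Sing}(D)$ (so it is $\infty$ if $\operatorname{Sing}(D)=\emptyset$), and let $\Omega^j_D = \bigwedge^j_{\mathcal{O}_D} \Omega^1_{\mathcal{O}_D/k}$. For an $\mathcal{O}_D$-module $M$ and a maximal ideal $\mathfrak{m}$ of $\mathcal{O}_D$, let $H^i_{\mathfrak{m}}(M)$ denote local cohomology with support in $\mathfrak{m}$, and let $\operatorname{Soc}(M) = \{x \in M : \mathfrak{m}x = 0\}$. Then for every maximal ideal $\mathfrak{m} \in \operatorname{Sing}(D)$ and all integers $i, j \ge 0$ with $j \le \operatorname{codim}_D \operatorname{Sing}(D)$: 1. if $i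 + j < d$, then $H^i_{\mathfrak{m}}(\Omega^j_D) = 0$; 2. if $i + j = d$, then $\operatorname{Soc}(H^i_{\mathfrak{m}}(\Omega^j_D)) \cong \operatorname{Soc}(H^d_{\mathfrak{m}}(\mathcal{O}_D)) \cong \mathcal{O}_D/\mathfrak{m}$ as $\mathcal{O}_D$-modules. In particular, for every integer $j \ge 0$ with $j \le \operatorname{codim}_D \operatorname{Sing}(D) - 2$, the $\mathcal{O}_D$-module $\Omega^j_D$ is reflexive, i.e. the canonical map from $\Omega^j_D$ to its double dual is an isomorphism. -/

import Mathlib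

universe u v

/-- A commutative ring is normal if all its localizations at primes are normal domains. -/
def IsNormalRing (A : Type u) [CommRing A] : Prop :=
  ∀ (p : Ideal A) [p.IsPrime],
    IsDomain (Localization.AtPrime p) ∧ IsIntegrallyClosed (Localization.AtPrime p)

/-- `Spec A` has pure dimension `d`: the local ring at every closed point has dimension `d`. -/
def HasPureDim (A : Type u) [CommRing A] (d : ℕ) : Prop :=
  ∀ (m : Ideal A) [m.IsMaximal], ringKrullDim (Localization.AtPrime m) = d

/-- The singular locus of `Spec A`: the points whose local ring is not regular. -/
def singularLocus (A : Type u) [CommRing A] : Set (PrimeSpectrum A) :=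
  {p | ¬ IsRegularLocalRing (Localization.AtPrime p.asIdeal)}

/-- The codimension of the singular locus in `Spec A`, i.e. the infimum of the heights of its
points. It is `⊤` exactly when the singular locus contains no point of finite height, so, for
Noetherian `A`, exactly when `A` is regular. -/
noncomputable def codimSing (A : Type u) [CommRing A] : ℕ∞ :=
  ⨅ p ∈ singularLocus A, p.asIdeal.height

/-- The module `Ω^j` of Kähler `j`-forms of the `k`-algebra `A`. -/
abbrev KaehlerForms (k : Type v) (A : Type u) [CommRing k] [CommRing A] [Algebra k A] (j : ℕ) :
    Type u :=
  ⋀[A]^j (Ω[A⁄k])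

/-- The local cohomology module `H^i_I(M)`. -/
noncomputable abbrev LocalCoh {A : Type u} [CommRing A] (I : Ideal A) (i : ℕ)
    (M : Type u) [AddCommGroup M] [Module A M] : ModuleCat.{u} A :=
  (localCohomology I i).obj (ModuleCat.of A M)

/-- The socle `M[I] = {x ∈ M | I x = 0}` of `M` with respect to `I`. -/
abbrev socle {A : Type u} [CommRing A] (I : Ideal A) (M : Type u) [AddCommGroup M] [Module A M] :
    Submodule A M :=
  Submodule.torsionBySet A M (I : Set A)

/-! Put A = R/(f), M = A ⊗ Ω_{R/k} and w = 1 ⊗ df. Then M is finite projective and Ω_A = M/Aw. The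
values at w of the linear forms on M make up the Jacobian ideal J, and V(J) = Sing(D) because k is
perfect. As R is regular and f is a nonzerodivisor, A is Cohen–Macaulay, so J contains an A-regular
sequence of any length c ≤ codim Sing(D) (`exists_isWeaklyRegular_jacobianIdeal`).

By de Rham–Saito division (`exteriorPower.ker_wedge_eq_wedgeRange`), forms in ⋀^n M with n < c that
are killed by w are multiples of w. Hence w ∧ · induces exact sequences 0 → Ω^n_A → ⋀^{n+1} M →
Ω^{n+1}_A → 0 for n < c (`exteriorPower.exists_wedge_lift`).

The middle terms are projective, so their Ext^l(A/m, ·) vanish for l < d. Shifting degrees along the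
sequences embeds Ext^l(A/m, Ω^j_A) into Ext^{l+j}(A/m, A) for l + j ≤ d. This is 0 for l + j < d.
For l + j = d the embedding is onto: the only map that does not vanish for degree reasons is
Ext^d(A/m, A) → Ext^d(A/m, M), induced by 1 ↦ w. The coordinates of w lie in J, and J ⊆ m because m
is singular, so this map is zero too. Finally Ext^d(A/m, A) ≅ A/m since A is Gorenstein
(`nonempty_modExt_quotient_self_equiv`).

Local cohomology is the colimit of Ext^i(A/m^t, ·): it vanishes where Ext^i(A/m, ·) does, and in the
lowest degree its socle is Ext^i(A/m, ·) (`subsingleton_localCoh`, `nonempty_socle_localCoh_equiv`).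

If j + 2 ≤ codim Sing(D), two consecutive sequences exhibit Ω^j_A as the kernel of ⋀^{j+1} M →
⋀^{j+2} M, a map of reflexive modules. Contraction with a form taking a regular value at w then
gives reflexivity (`Module.IsReflexive.of_exact`). -/

/-! ### Comparison of the derived-functor `Ext` with `Abelian.Ext`. -/

section ExtBridge

open CategoryTheory Limits Abelian Opposite

namespace CategoryTheory.ProjectiveResolution

section

variable {C : Type u} [Category.{v} C] [Abelian C] [HasExt.{v} C] {X Y : C}
  (P : ProjectiveResolution X)

lemma extMk_zero_eq_zero_iff (f : P.complex.X 0 ⟶ Y) (hf : P.complex.d 1 0 ≫ f = 0) :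
    P.extMk f 1 (zero_add 1) hf = 0 ↔ f = 0 := by
  refine ⟨fun h ↦ ?_, ?_⟩
  · rw [← P.extEquivCohomologyClass.apply_eq_iff_eq, extEquivCohomologyClass_extMk,
      extEquivCohomologyClass_zero, CochainComplex.HomComplex.CohomologyClass.mk_eq_zero_iff,
      CochainComplex.HomComplex.Cocycle.toSingleMk_mem_coboundaries_iff _ _ _ _ _ 1 (by simp)] at h
    obtain ⟨g, hg⟩ := h
    -- The resolution is zero in cohomological degree 1, so in degree 0 there are no nonzero
    -- coboundaries.
    have hz : P.cochainComplex.d (-(0 : ℕ)) 1 = 0 :=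
      (P.cochainComplex.isZero_of_isStrictlyLE 0 1 (by simp)).eq_of_tgt _ _
    rw [hz, zero_comp] at hg
    exact (Iso.cancel_iso_hom_left _ _ _).mp (hg.symm.trans (comp_zero).symm)
  · rintro rfl
    exact extMk_zero _ _ _

lemma extMk_eq_zero_iff_next (n : ℕ) (f : P.complex.X n ⟶ Y) (m : ℕ) (hm : n + 1 = m)
    (hf : P.complex.d m n ≫ f = 0) :
    P.extMk f m hm hf = 0 ↔
      ∃ g : P.complex.X ((ComplexShape.down ℕ).next n) ⟶ Y,
        P.complex.d n ((ComplexShape.down ℕ).next n) ≫ g = f := by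
  subst hm
  cases n with
  | zero =>
    rw [extMk_zero_eq_zero_iff]
    -- `next 0` takes the default value 0, and the differential from 0 to 0 is zero.
    have : P.complex.d 0 ((ComplexShape.down ℕ).next 0) = 0 := by
      rw [ChainComplex.next_nat_zero]
      exact P.complex.shape _ _ (by simp)
    rw [this]
    exact ⟨fun h ↦ ⟨0, by simp [h]⟩, fun ⟨g, hg⟩ ↦ by simpa using hg.symm⟩
  | succ n => exact P.extMk_eq_zero_iff f _ _ hf _ (by rw [ChainComplex.next_nat_succ])

end

section

variable (R : Type*) [Ring R] {C : Type u} [Category.{v} C] [Abelian C] [Linear R C]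
  {X : C} (P : ProjectiveResolution X) (Y : C) (n : ℕ)

/-- The complex of modules of morphisms into `Y`, as a chain complex in the opposite category. -/
noncomputable abbrev yonedaComplex : ChainComplex (ModuleCat.{v} R)ᵒᵖ ℕ :=
  (((linearYoneda R C).obj Y).rightOp.mapHomologicalComplex _).obj P.complex

/-- The module of `n`-cocycles with values in `Y`. -/
noncomputable abbrev extCocycles : ModuleCat.{v} R := ((P.yonedaComplex R Y).opcycles n).unop

/-- Opcycles are a cokernel in the opposite category, hence a kernel of modules; the projection onto
them becomes the inclusion of the cocycles into the cochains. -/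
noncomputable def extCocyclesι : P.extCocycles R Y n →ₗ[R] (P.complex.X n ⟶ Y) :=
  ((P.yonedaComplex R Y).pOpcycles n).unop.hom

lemma extCocyclesι_injective : Function.Injective (P.extCocyclesι R Y n) :=
  (ModuleCat.mono_iff_injective ((P.yonedaComplex R Y).pOpcycles n).unop).mp inferInstance

lemma d_comp_extCocyclesι (m : ℕ) (z : P.extCocycles R Y n) :
    P.complex.d m n ≫ P.extCocyclesι R Y n z = 0 := by
  have := congrArg Quiver.Hom.unop ((P.yonedaComplex R Y).d_pOpcycles m n)
  exact ConcreteCategory.congr_hom this z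

lemma exists_extCocyclesι_eq (f : P.complex.X n ⟶ Y)
    (hf : P.complex.d (n + 1) n ≫ f = 0) : ∃ z, P.extCocyclesι R Y n z = f := by
  let K := P.yonedaComplex R Y
  have ex : (ShortComplex.mk (K.d (n + 1) n) (K.pOpcycles n) (by simp)).Exact :=
    ShortComplex.exact_of_g_is_cokernel _ (K.opcyclesIsCokernel (n + 1) n (by simp))
  obtain ⟨z, hz⟩ := (ShortComplex.moduleCat_exact_iff _).mp ex.unop f hf
  exact ⟨z, hz⟩

/-- The derived functor `Ext` computed by a projective resolution. -/
noncomputable def homologyYonedaComplexIso [EnoughProjectives C] :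
    (((linearYoneda R C).obj Y).rightOp.leftDerived n).obj X ≅
      (P.yonedaComplex R Y).homology n :=
  P.isoLeftDerivedObj (((linearYoneda R C).obj Y).rightOp) n

lemma homologyYonedaComplexIso_naturality [EnoughProjectives C] {X' : C}
    (P' : ProjectiveResolution X') {g : X' ⟶ X} (φ : P'.Hom P g) :
    (((linearYoneda R C).obj Y).rightOp.leftDerived n).map g ≫
      (P.homologyYonedaComplexIso R Y n).hom =
    (P'.homologyYonedaComplexIso R Y n).hom ≫ HomologicalComplex.homologyMap
      ((((linearYoneda R C).obj Y).rightOp.mapHomologicalComplex _).map φ.hom) n :=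
  isoLeftDerivedObj_hom_naturality g P' P φ.hom
    (φ.hom_f_zero_comp_π_f_zero.trans (by rw [ChainComplex.single₀_map_f_zero]; rfl))
    ((linearYoneda R C).obj Y).rightOp n

/-- The class of a cocycle in the derived functor `Ext`. -/
noncomputable def extClassMap [EnoughProjectives C] :
    P.extCocycles R Y n →ₗ[R] ((Ext R C n).obj (op X)).obj Y :=
  ((P.homologyYonedaComplexIso R Y n).hom ≫
    (P.yonedaComplex R Y).homologyι n).unop.hom

lemma extClassMap_surjective [EnoughProjectives C] :
    Function.Surjective (P.extClassMap R Y n) :=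
  (ModuleCat.epi_iff_surjective ((P.homologyYonedaComplexIso R Y n).hom ≫
    (P.yonedaComplex R Y).homologyι n).unop).mp inferInstance

lemma extClassMap_eq_zero_iff [EnoughProjectives C] (z : P.extCocycles R Y n) :
    P.extClassMap R Y n z = 0 ↔
      ∃ g : P.complex.X ((ComplexShape.down ℕ).next n) ⟶ Y,
        P.complex.d n ((ComplexShape.down ℕ).next n) ≫ g = P.extCocyclesι R Y n z := by
  let K := P.yonedaComplex R Y
  have ex : (ShortComplex.mk (K.homologyι n) (K.fromOpcycles n ((ComplexShape.down ℕ).next n))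
      (by simp)).Exact :=
    ShortComplex.exact_of_f_is_kernel _ (K.homologyIsKernel n _ rfl)
  have ex' := (ShortComplex.moduleCat_exact_iff _).mp ex.unop z
  have hinj : Function.Injective
      (P.homologyYonedaComplexIso R Y n).hom.unop.hom :=
    (ModuleCat.mono_iff_injective _).mp inferInstance
  have hd (g) : P.extCocyclesι R Y n
      ((K.fromOpcycles n ((ComplexShape.down ℕ).next n)).unop.hom g) =
        P.complex.d n ((ComplexShape.down ℕ).next n) ≫ g :=
    ConcreteCategory.congr_hom (congrArg Quiver.Hom.unop
      (K.p_fromOpcycles n ((ComplexShape.down ℕ).next n))) g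
  constructor
  · intro h
    obtain ⟨g, hg⟩ := ex' (hinj (h.trans (map_zero _).symm))
    exact ⟨g, (hd g).symm.trans (congrArg _ hg)⟩
  · rintro ⟨g, hg⟩
    have hz : (K.fromOpcycles n ((ComplexShape.down ℕ).next n)).unop.hom g = z :=
      P.extCocyclesι_injective R Y n ((hd g).trans hg)
    have h0 : (K.homologyι n).unop.hom z = 0 := by
      rw [← hz]
      exact ConcreteCategory.congr_hom (congrArg Quiver.Hom.unop
        (K.homologyι_comp_fromOpcycles n ((ComplexShape.down ℕ).next n))) g
    exact (congrArg (P.homologyYonedaComplexIso R Y n).hom.unop.hom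
      h0).trans (LinearMap.map_zero _)

lemma extClassMap_naturality [EnoughProjectives C] {X' : C} (P' : ProjectiveResolution X')
    {g : X' ⟶ X} (φ : P'.Hom P g) (z : P.extCocycles R Y n) :
    ∃ z' : P'.extCocycles R Y n,
      P'.extCocyclesι R Y n z' = φ.hom.f n ≫ P.extCocyclesι R Y n z ∧
      P'.extClassMap R Y n z' = (((Ext R C n).map g.op).app Y).hom (P.extClassMap R Y n z) := by
  let F := ((linearYoneda R C).obj Y).rightOp
  let ψ : P'.yonedaComplex R Y ⟶ P.yonedaComplex R Y := (F.mapHomologicalComplex _).map φ.hom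
  refine ⟨(HomologicalComplex.opcyclesMap ψ n).unop.hom z, ?_, ?_⟩
  · exact ConcreteCategory.congr_hom (congrArg Quiver.Hom.unop
      (HomologicalComplex.p_opcyclesMap ψ n)) z
  · have h1 : (F.leftDerived n).map g ≫ (P.homologyYonedaComplexIso R Y n).hom ≫
        (P.yonedaComplex R Y).homologyι n =
        ((P'.homologyYonedaComplexIso R Y n).hom ≫ (P'.yonedaComplex R Y).homologyι n) ≫
          HomologicalComplex.opcyclesMap ψ n := by
      rw [← Category.assoc, homologyYonedaComplexIso_naturality R P Y n P' φ, Category.assoc,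
        Category.assoc]
      congr 1
      exact HomologicalComplex.homologyι_naturality ψ n
    exact (ConcreteCategory.congr_hom (congrArg Quiver.Hom.unop h1) z).symm

end

section

variable {R : Type*} [Ring R] {C : Type u} [Category.{v} C] [Abelian C] [Linear R C]
  [HasExt.{v} C] {X Y : C} (P : ProjectiveResolution X) (n : ℕ)

variable (R Y) in
/-- The class of a cocycle in `Abelian.Ext`. -/
noncomputable def abelianExtClassMap : P.extCocycles R Y n →ₗ[R] Abelian.Ext X Y n where
  toFun z := P.extMk (P.extCocyclesι R Y n z) (n + 1) rfl (P.d_comp_extCocyclesι R Y n _ z)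
  map_add' z w := by simp only [map_add, add_extMk]
  map_smul' r z := by
    rw [Ext.smul_eq_comp_mk₀, RingHom.id_apply, extMk_comp_mk₀]
    congr 1
    simp

lemma abelianExtClassMap_surjective : Function.Surjective (P.abelianExtClassMap R Y n) := by
  intro α
  obtain ⟨f, hf, rfl⟩ := P.extMk_surjective α (n + 1) rfl
  obtain ⟨z, rfl⟩ := P.exists_extCocyclesι_eq R Y n f hf
  exact ⟨z, rfl⟩

/-- Both versions of Ext are quotients of one module of cocycles, and in both the classes that
vanish are those of coboundaries. This equality of kernels is what identifies the two. -/
lemma ker_abelianExtClassMap [EnoughProjectives C] :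
    LinearMap.ker (P.abelianExtClassMap R Y n) = LinearMap.ker (P.extClassMap R Y n) := by
  ext z
  rw [LinearMap.mem_ker, LinearMap.mem_ker, extClassMap_eq_zero_iff]
  exact P.extMk_eq_zero_iff_next n _ _ rfl (P.d_comp_extCocyclesι R Y n _ z)

end

end CategoryTheory.ProjectiveResolution

section

variable (R : Type*) [Ring R] {C : Type u} [Category.{v} C] [Abelian C] [Linear R C]
  [HasExt.{v} C] [EnoughProjectives C]

/-- The derived functor `Ext` agrees with `Abelian.Ext`. -/
noncomputable def extLinearEquivAbelianExt (X Y : C) (n : ℕ) :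
    ((Ext R C n).obj (op X)).obj Y ≃ₗ[R] Abelian.Ext X Y n :=
  (((projectiveResolution X).extClassMap R Y n).quotKerEquivOfSurjective
    ((projectiveResolution X).extClassMap_surjective R Y n)).symm ≪≫ₗ
  Submodule.quotEquivOfEq _ _ ((projectiveResolution X).ker_abelianExtClassMap n).symm ≪≫ₗ
  ((projectiveResolution X).abelianExtClassMap R Y n).quotKerEquivOfSurjective
    ((projectiveResolution X).abelianExtClassMap_surjective n)

lemma extLinearEquivAbelianExt_extClassMap (X Y : C) (n : ℕ)
    (z : (projectiveResolution X).extCocycles R Y n) :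
    extLinearEquivAbelianExt R X Y n ((projectiveResolution X).extClassMap R Y n z) =
      (projectiveResolution X).abelianExtClassMap R Y n z := by
  have : (((projectiveResolution X).extClassMap R Y n).quotKerEquivOfSurjective
      ((projectiveResolution X).extClassMap_surjective R Y n)).symm
      ((projectiveResolution X).extClassMap R Y n z) = Submodule.Quotient.mk z := by
    rw [LinearEquiv.symm_apply_eq]; rfl
  simp only [extLinearEquivAbelianExt, LinearEquiv.trans_apply, this]
  rfl

lemma extLinearEquivAbelianExt_naturality {X X' : C} (g : X' ⟶ X) (Y : C) (n : ℕ)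
    (x : ((Ext R C n).obj (op X)).obj Y) :
    extLinearEquivAbelianExt R X' Y n ((((Ext R C n).map g.op).app Y).hom x) =
      (Ext.mk₀ g).comp (extLinearEquivAbelianExt R X Y n x) (zero_add n) := by
  obtain ⟨z, rfl⟩ := (projectiveResolution X).extClassMap_surjective R Y n x
  let φ : (projectiveResolution X').Hom (projectiveResolution X) g :=
    ⟨ProjectiveResolution.lift g _ _, by
      rw [ChainComplex.single₀_map_f_zero]; exact ProjectiveResolution.lift_commutes_zero g _ _⟩
  obtain ⟨z', h1, h2⟩ := (projectiveResolution X).extClassMap_naturality R Y n _ φ z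
  rw [← h2, extLinearEquivAbelianExt_extClassMap, extLinearEquivAbelianExt_extClassMap]
  simp only [ProjectiveResolution.abelianExtClassMap, LinearMap.coe_mk, AddHom.coe_mk]
  rw [ProjectiveResolution.mk₀_comp_extMk _ _ _ _ φ]
  congr 1

end

end ExtBridge

/-! ### Functoriality of Ext of modules and vanishing on torsion modules. -/

section ExtTorsion

open CategoryTheory Limits Opposite Abelian

variable {A : Type u} [CommRing A]

/-- The module `Ext^i(N, M)` for modules `N` and `M`. -/
noncomputable abbrev ModExt (A : Type u) [CommRing A] (N M : Type u) [AddCommGroup N] [Module A N]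
    [AddCommGroup M] [Module A M] (i : ℕ) : Type u :=
  Abelian.Ext (ModuleCat.of A N) (ModuleCat.of A M) i

section

variable {N N' N'' M M' M'' : Type u} [AddCommGroup N] [Module A N] [AddCommGroup N'] [Module A N']
  [AddCommGroup N''] [Module A N''] [AddCommGroup M] [Module A M] [AddCommGroup M'] [Module A M']
  [AddCommGroup M''] [Module A M'']

variable (M) in
/-- Functoriality of `Ext` in the first variable. -/
noncomputable def ModExt.precomp (g : N →ₗ[A] N') (i : ℕ) : ModExt A N' M i →ₗ[A] ModExt A N M i where
  toFun x := (Ext.mk₀ (ModuleCat.ofHom g)).comp x (zero_add i)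
  map_add' x y := by simp
  map_smul' r x := by simp

variable (N) in
/-- Functoriality of `Ext` in the second variable. -/
noncomputable def ModExt.postcomp (g : M →ₗ[A] M') (i : ℕ) : ModExt A N M i →ₗ[A] ModExt A N M' i where
  toFun x := x.comp (Ext.mk₀ (ModuleCat.ofHom g)) (add_zero i)
  map_add' x y := by simp
  map_smul' r x := by simp

lemma ModExt.precomp_comp (g : N →ₗ[A] N') (g' : N' →ₗ[A] N'') (i : ℕ) (x : ModExt A N'' M i) :
    ModExt.precomp M (g' ∘ₗ g) i x = ModExt.precomp M g i (ModExt.precomp M g' i x) := by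
  simp [ModExt.precomp, ModuleCat.ofHom_comp]

lemma ModExt.postcomp_comp (g : M →ₗ[A] M') (g' : M' →ₗ[A] M'') (i : ℕ) (x : ModExt A N M i) :
    ModExt.postcomp N (g' ∘ₗ g) i x = ModExt.postcomp N g' i (ModExt.postcomp N g i x) := by
  simp [ModExt.postcomp, ModuleCat.ofHom_comp]

variable (M) in
lemma ModExt.precomp_sum_smul {ι : Type*} (s : Finset ι) (a : ι → A) (g : ι → N →ₗ[A] N') (i : ℕ)
    (x : ModExt A N' M i) :
    ModExt.precomp M (∑ k ∈ s, a k • g k) i x = ∑ k ∈ s, a k • ModExt.precomp M (g k) i x := by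
  classical
  induction s using Finset.induction_on with
  | empty =>
    simp [ModExt.precomp]
  | insert k s hk ih =>
    rw [Finset.sum_insert hk, Finset.sum_insert hk, ← ih]
    simp only [ModExt.precomp, LinearMap.coe_mk, AddHom.coe_mk, ModuleCat.ofHom_add,
      Ext.mk₀_add, Ext.add_comp]
    congr 1
    rw [← Ext.smul_comp, ← Ext.mk₀_smul]
    rfl

lemma ModExt.postcomp_sum_smul {ι : Type*} (s : Finset ι) (a : ι → A) (g : ι → M →ₗ[A] M') (i : ℕ)
    (x : ModExt A N M i) :
    ModExt.postcomp N (∑ k ∈ s, a k • g k) i x = ∑ k ∈ s, a k • ModExt.postcomp N (g k) i x := by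
  classical
  induction s using Finset.induction_on with
  | empty =>
    simp [ModExt.postcomp]
  | insert k s hk ih =>
    rw [Finset.sum_insert hk, Finset.sum_insert hk, ← ih]
    simp only [ModExt.postcomp, LinearMap.coe_mk, AddHom.coe_mk, ModuleCat.ofHom_add,
      Ext.mk₀_add, Ext.comp_add]
    congr 1
    rw [← Ext.comp_smul, ← Ext.mk₀_smul]
    rfl

variable (M) in
lemma ModExt.precomp_id (i : ℕ) (x : ModExt A N M i) : ModExt.precomp M LinearMap.id i x = x := by
  simp [ModExt.precomp]

lemma ModExt.postcomp_id (i : ℕ) (x : ModExt A N M i) : ModExt.postcomp N LinearMap.id i x = x := by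
  simp [ModExt.postcomp]

variable (M) in
lemma ModExt.precomp_smul_id (a : A) (i : ℕ) (x : ModExt A N M i) :
    ModExt.precomp M (a • LinearMap.id) i x = a • x := by
  have := ModExt.precomp_sum_smul M (Finset.univ : Finset Unit) (fun _ ↦ a)
    (fun _ ↦ (LinearMap.id : N →ₗ[A] N)) i x
  simpa [ModExt.precomp_id] using this

lemma ModExt.postcomp_smul_id (a : A) (i : ℕ) (x : ModExt A N M i) :
    ModExt.postcomp N (a • LinearMap.id) i x = a • x := by
  have := ModExt.postcomp_sum_smul (Finset.univ : Finset Unit) (fun _ ↦ a)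
    (fun _ ↦ (LinearMap.id : M →ₗ[A] M)) i x
  simpa [ModExt.postcomp_id] using this

/-- A scalar acts on Ext through the first variable, where it is the zero map. -/
lemma ModExt.smul_eq_zero {a : A} (ha : ∀ n : N, a • n = 0) (i : ℕ) (x : ModExt A N M i) :
    a • x = 0 := by
  rw [← ModExt.precomp_smul_id M]
  have : a • (LinearMap.id : N →ₗ[A] N) = 0 := by ext; simp [ha]
  rw [this]
  simpa using ModExt.precomp_sum_smul M (∅ : Finset Unit) (fun _ ↦ (0 : A))
    (fun _ ↦ (0 : N →ₗ[A] N)) i x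

/-- The linear equivalence on `Ext` induced by an equivalence in the second variable. -/
noncomputable def ModExt.congrRight (N : Type u) [AddCommGroup N] [Module A N] (e : M ≃ₗ[A] M')
    (i : ℕ) : ModExt A N M i ≃ₗ[A] ModExt A N M' i :=
  LinearEquiv.ofLinearMap (ModExt.postcomp N e.toLinearMap i) (ModExt.postcomp N e.symm.toLinearMap i)
    (by ext x; simp [← ModExt.postcomp_comp, ModExt.postcomp_id])
    (by ext x; simp [← ModExt.postcomp_comp, ModExt.postcomp_id])

/-- The linear equivalence on `Ext` induced by an equivalence in the first variable. -/
noncomputable def ModExt.congrLeft (M : Type u) [AddCommGroup M] [Module A M] (e : N ≃ₗ[A] N')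
    (i : ℕ) : ModExt A N' M i ≃ₗ[A] ModExt A N M i :=
  LinearEquiv.ofLinearMap (ModExt.precomp M e.toLinearMap i) (ModExt.precomp M e.symm.toLinearMap i)
    (by ext x; simp [← ModExt.precomp_comp, ModExt.precomp_id])
    (by ext x; simp [← ModExt.precomp_comp, ModExt.precomp_id])

/-- `Ext` in degree zero is the module of homomorphisms. -/
noncomputable def ModExt.zeroEquiv (N M : Type u) [AddCommGroup N] [Module A N]
    [AddCommGroup M] [Module A M] : ModExt A N M 0 ≃ₗ[A] (N →ₗ[A] M) :=
  (Ext.linearEquiv₀ (R := A)).trans ModuleCat.homLinearEquiv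

/-- The short exact sequence of modules attached to an injection and a surjection. -/
lemma shortExact_of_modules {f : N →ₗ[A] N'} {g : N' →ₗ[A] N''} (hf : Function.Injective f)
    (hg : Function.Surjective g) (h : Function.Exact f g) :
    (ShortComplex.mk (ModuleCat.ofHom f) (ModuleCat.ofHom g)
      (by ext x; exact h.apply_apply_eq_zero x)).ShortExact :=
  ModuleCat.shortComplex_shortExact _ h hf hg

lemma ModExt.exists_precomp_eq {f : N →ₗ[A] N'} {g : N' →ₗ[A] N''} (hf : Function.Injective f)
    (hg : Function.Surjective g) (h : Function.Exact f g) (i : ℕ) (x : ModExt A N' M i)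
    (hx : ModExt.precomp M f i x = 0) : ∃ y, ModExt.precomp M g i y = x :=
  Ext.contravariant_sequence_exact₂ (shortExact_of_modules hf hg h) _ x hx

/-- The kernel of Ext^i(N'', M) → Ext^i(N', M) is the image of Ext^{i-1}(N, M). -/
lemma ModExt.precomp_injective {f : N →ₗ[A] N'} {g : N' →ₗ[A] N''} (hf : Function.Injective f)
    (hg : Function.Surjective g) (h : Function.Exact f g) (i : ℕ)
    (h0 : ∀ l < i, Subsingleton (ModExt A N M l)) : Function.Injective (ModExt.precomp M g i) := by
  rw [injective_iff_map_eq_zero]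
  intro x hx
  cases i with
  | zero =>
    have : Epi (ModuleCat.ofHom g) := (ModuleCat.epi_iff_surjective _).mpr hg
    exact Ext.precomp_mk₀_injective_of_epi _ (ModuleCat.ofHom g) (hx.trans (by simp))
  | succ i =>
    obtain ⟨y, rfl⟩ := Ext.contravariant_sequence_exact₃ (shortExact_of_modules hf hg h) _ x hx
      (add_comm 1 i)
    have := h0 i (Nat.lt_succ_self i)
    rw [Subsingleton.elim y 0, Ext.comp_zero]

lemma ModExt.subsingleton_of_exact {f : N →ₗ[A] N'} {g : N' →ₗ[A] N''} (hf : Function.Injective f)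
    (hg : Function.Surjective g) (h : Function.Exact f g) (i : ℕ)
    (h1 : Subsingleton (ModExt A N M i)) (h3 : Subsingleton (ModExt A N'' M i)) :
    Subsingleton (ModExt A N' M i) := by
  refine subsingleton_of_forall_eq 0 fun x ↦ ?_
  obtain ⟨y, rfl⟩ := ModExt.exists_precomp_eq hf hg h i x (Subsingleton.elim _ _)
  rw [Subsingleton.elim y 0, map_zero]

end

/-- Dévissage along a prime filtration of T: each prime that occurs contains m^t, hence equals m, so
the graded pieces are copies of A/m. -/
lemma ModExt.subsingleton_of_pow_torsion [IsNoetherianRing A] (m : Ideal A) [hm : m.IsMaximal]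
    {M : Type u} [AddCommGroup M] [Module A M] (i : ℕ)
    (h : Subsingleton (ModExt A (A ⧸ m) M i))
    (T : Type u) [AddCommGroup T] [Module A T] [hT : Module.Finite A T] (t : ℕ)
    (ht : ∀ a ∈ m ^ t, ∀ x : T, a • x = 0) : Subsingleton (ModExt A T M i) := by
  induction hT using IsNoetherianRing.induction_on_isQuotientEquivQuotientPrime A with
  | @subsingleton N =>
    refine subsingleton_of_forall_eq 0 fun x ↦ ?_
    rw [← one_smul A x]
    exact ModExt.smul_eq_zero (fun n ↦ Subsingleton.elim _ _) i x
  | @quotient N _ _ _ p e =>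
    have hp : m ≤ p.asIdeal := by
      refine p.2.le_of_pow_le (n := t) fun a ha ↦ ?_
      have := ht a ha (e.symm 1)
      rw [← map_smul, LinearEquiv.map_eq_zero_iff, Algebra.smul_def, mul_one] at this
      exact Ideal.Quotient.eq_zero_iff_mem.mp this
    have hp' : m = p.asIdeal := hm.eq_of_le p.2.ne_top hp
    exact (ModExt.congrLeft M (e.trans (Submodule.quotEquivOfEq _ _ hp'.symm))
      i).symm.toEquiv.subsingleton
  | exact N₁ N₂ N₃ f g hf hg hfg h1 h3 =>
    refine ModExt.subsingleton_of_exact hf hg hfg i (h1 fun a ha x ↦ ?_) (h3 fun a ha x ↦ ?_)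
    · exact hf (by rw [map_smul, ht a ha, map_zero])
    · obtain ⟨y, rfl⟩ := hg x
      rw [← map_smul, ht a ha, map_zero]

end ExtTorsion

/-! ### Local cohomology as a colimit of Ext, and its socle in the lowest degree. -/

section LocalCohomologySocle

open CategoryTheory Limits Opposite Abelian

variable {A : Type u} [CommRing A]

/-- The obstruction to descending x to A/m is its restriction to K = m/m^t. Generators a_k of K
lifted to m give a surjection (A/m^t)^n → K whose composite with the inclusion of K is ∑ a_k •
proj_k, so the pullback of x is ∑ a_k • (proj_k^* x) = 0. Pullback along the surjection is injective
because its kernel is m^t-torsion, hence without Ext below degree i. -/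
lemma ModExt.exists_precomp_factor_eq [IsNoetherianRing A] (m : Ideal A) [m.IsMaximal] {t : ℕ}
    (ht : t ≠ 0) {N : Type u} [AddCommGroup N] [Module A N] (i : ℕ)
    (h : ∀ l < i, Subsingleton (ModExt A (A ⧸ m) N l)) (x : ModExt A (A ⧸ m ^ t) N i)
    (hx : ∀ a ∈ m, a • x = 0) :
    ∃ y, ModExt.precomp N (Submodule.factor (Ideal.pow_le_self ht)) i y = x := by
  set g := Submodule.factor (Ideal.pow_le_self ht : m ^ t ≤ m) with hg
  have hgs : Function.Surjective g := Submodule.factor_surjective _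
  let K := LinearMap.ker g
  refine ModExt.exists_precomp_eq (f := K.subtype) Subtype.val_injective hgs
    (LinearMap.exact_subtype_ker_map g) i x ?_
  obtain ⟨n, y, hy⟩ := Submodule.fg_iff_exists_fin_generating_family.mp
    ((inferInstance : IsNoetherian A (A ⧸ m ^ t)).noetherian K)
  have hym (k : Fin n) : ∃ a ∈ m, Submodule.Quotient.mk a = y k := by
    obtain ⟨a, ha⟩ := Submodule.Quotient.mk_surjective _ (y k)
    refine ⟨a, ?_, ha⟩
    have : g (y k) = 0 := by
      have : y k ∈ K := hy ▸ Submodule.subset_span ⟨k, rfl⟩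
      exact this
    rw [← ha] at this
    exact (Submodule.Quotient.mk_eq_zero _).mp this
  choose a ha hay using hym
  let q : (Fin n → A ⧸ m ^ t) →ₗ[A] A ⧸ m ^ t := ∑ k, a k • LinearMap.proj k
  have hq (z) : q z = ∑ k, a k • z k := by simp [q]
  have hay' (k : Fin n) (b : A) : a k • (Submodule.Quotient.mk b : A ⧸ m ^ t) = b • y k := by
    rw [← hay, ← Submodule.Quotient.mk_smul, ← Submodule.Quotient.mk_smul, smul_eq_mul,
      smul_eq_mul, mul_comm]
  have hqr : LinearMap.range q = K := by
    rw [← hy]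
    refine le_antisymm ?_ (Submodule.span_le.mpr ?_)
    · rintro _ ⟨z, rfl⟩
      rw [hq]
      refine Submodule.sum_mem _ fun k _ ↦ ?_
      obtain ⟨b, hb⟩ := Submodule.Quotient.mk_surjective _ (z k)
      rw [← hb, hay']
      exact Submodule.smul_mem _ _ (Submodule.subset_span ⟨k, rfl⟩)
    · rintro _ ⟨k, rfl⟩
      refine ⟨Pi.single k (Submodule.Quotient.mk 1), ?_⟩
      rw [hq, Finset.sum_eq_single k (fun l _ hl ↦ by simp [hl]) (by simp)]
      simpa using hay' k 1
  let p : (Fin n → A ⧸ m ^ t) →ₗ[A] K := q.codRestrict K fun z ↦ hqr ▸ ⟨z, rfl⟩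
  have hp : Function.Surjective p := by
    rintro ⟨z, hz⟩
    rw [← hqr] at hz
    obtain ⟨w, hw⟩ := hz
    exact ⟨w, Subtype.ext hw⟩
  have htors (b) (hb : b ∈ m ^ t) (z : A ⧸ m ^ t) : b • z = 0 := by
    obtain ⟨c, rfl⟩ := Submodule.Quotient.mk_surjective _ z
    rw [← Submodule.Quotient.mk_smul, Submodule.Quotient.mk_eq_zero]
    exact Ideal.mul_mem_right _ _ hb
  refine ModExt.precomp_injective (f := (LinearMap.ker p).subtype) Subtype.val_injective hp
    (LinearMap.exact_subtype_ker_map p) i (fun l hl ↦ ?_) ?_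
  · refine ModExt.subsingleton_of_pow_torsion m l (h l hl) _ t fun b hb z ↦ ?_
    refine Subtype.ext (funext fun k ↦ ?_)
    exact htors b hb (z.1 k)
  · rw [← ModExt.precomp_comp, map_zero]
    have : K.subtype ∘ₗ p = q := rfl
    rw [this, ModExt.precomp_sum_smul]
    refine Finset.sum_eq_zero fun k _ ↦ ?_
    rw [← map_smul, hx _ (ha k), map_zero]

/-- In the lowest degree the transition maps of the directed system are injective: the kernel of
A/m^t → A/m^s is m^t-torsion. -/
lemma ModExt.precomp_factor_injective [IsNoetherianRing A] (m : Ideal A) [m.IsMaximal] {s t : ℕ}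
    (hst : s ≤ t) {N : Type u} [AddCommGroup N] [Module A N] (i : ℕ)
    (h : ∀ l < i, Subsingleton (ModExt A (A ⧸ m) N l)) :
    Function.Injective (ModExt.precomp N
      (Submodule.factor (Ideal.pow_le_pow_right hst : m ^ t ≤ m ^ s)) i) := by
  refine ModExt.precomp_injective (f := (LinearMap.ker _).subtype) Subtype.val_injective
    (Submodule.factor_surjective _) (LinearMap.exact_subtype_ker_map _) i (fun l hl ↦ ?_)
  refine ModExt.subsingleton_of_pow_torsion m l (h l hl) _ t fun b hb z ↦ Subtype.ext ?_
  obtain ⟨c, hc⟩ := Submodule.Quotient.mk_surjective _ z.1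
  rw [Submodule.coe_smul, ← hc, ← Submodule.Quotient.mk_smul]
  exact (Submodule.Quotient.mk_eq_zero _).mpr (Ideal.mul_mem_right _ _ hb)

instance preservesColimit_forget_nat_op_op (F : (ℕᵒᵖ)ᵒᵖ ⥤ ModuleCat.{u} A) :
    PreservesColimit F (forget (ModuleCat.{u} A)) :=
  have : PreservesFilteredColimitsOfSize.{0, 0} (forget (ModuleCat.{u} A)) :=
    preservesSmallestFilteredColimits_of_preservesFilteredColimits.{u, u} _
  inferInstance

/-- The directed system `Ext^i(A / I ^ t, N)` whose colimit is local cohomology. -/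
noncomputable abbrev localCohomologySystem (I : Ideal A) (i : ℕ) (N : Type u) [AddCommGroup N]
    [Module A N] : (ℕᵒᵖ)ᵒᵖ ⥤ ModuleCat.{u} A :=
  localCohomology.diagram (localCohomology.idealPowersDiagram I) i ⋙
    (evaluation _ _).obj (ModuleCat.of A N)

/-- The maps from the directed system `Ext^i(A / I ^ t, N)` to local cohomology. -/
noncomputable def localCohomologyCocone (I : Ideal A) (i : ℕ) (N : Type u) [AddCommGroup N]
    [Module A N] : Cocone (localCohomologySystem I i N) :=
  ((evaluation _ _).obj (ModuleCat.of A N)).mapCocone (colimit.cocone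
    (localCohomology.diagram (localCohomology.idealPowersDiagram I) i))

noncomputable def localCohomologyIsColimit (I : Ideal A) (i : ℕ) (N : Type u) [AddCommGroup N]
    [Module A N] : IsColimit (localCohomologyCocone I i N) :=
  isColimitOfPreserves ((evaluation _ _).obj (ModuleCat.of A N)) (colimit.isColimit
    (localCohomology.diagram (localCohomology.idealPowersDiagram I) i))

/-- The terms of the directed system in terms of `ModExt`. -/
noncomputable def localCohomologySystemEquiv (I : Ideal A) (i : ℕ) (N : Type u) [AddCommGroup N]
    [Module A N] (t : ℕ) :
    (localCohomologySystem I i N).obj (op (op t)) ≃ₗ[A] ModExt A (A ⧸ I ^ t) N i :=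
  extLinearEquivAbelianExt A (ModuleCat.of A (A ⧸ I ^ t)) (ModuleCat.of A N) i

lemma localCohomologySystemEquiv_map (I : Ideal A) (i : ℕ) (N : Type u) [AddCommGroup N]
    [Module A N] {s t : ℕ} (f : op (op s) ⟶ op (op t)) (hst : s ≤ t)
    (x : (localCohomologySystem I i N).obj (op (op s))) :
    localCohomologySystemEquiv I i N t ((localCohomologySystem I i N).map f x) =
      ModExt.precomp N (Submodule.factor (Ideal.pow_le_pow_right hst : I ^ t ≤ I ^ s)) i
        (localCohomologySystemEquiv I i N s x) :=
  extLinearEquivAbelianExt_naturality A (ModuleCat.ofHom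
    (Submodule.factor (Ideal.pow_le_pow_right hst : I ^ t ≤ I ^ s))) (ModuleCat.of A N) i x

lemma le_of_op_op_hom {s t : ℕ} (f : op (op s) ⟶ op (op t)) : s ≤ t :=
  leOfHom f.unop.unop

/-- The map from `Ext^i(A / I ^ t, N)` to local cohomology. -/
noncomputable def toLocalCoh (I : Ideal A) (i : ℕ) (N : Type u) [AddCommGroup N]
    [Module A N] (t : ℕ) : ModExt A (A ⧸ I ^ t) N i →ₗ[A] LocalCoh I i N :=
  ((localCohomologyCocone I i N).ι.app (op (op t))).hom ∘ₗ
    (localCohomologySystemEquiv I i N t).symm.toLinearMap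

lemma toLocalCoh_localCohomologySystemEquiv (I : Ideal A) (i : ℕ) (N : Type u) [AddCommGroup N]
    [Module A N] (t : ℕ) (x : (localCohomologySystem I i N).obj (op (op t))) :
    toLocalCoh I i N t (localCohomologySystemEquiv I i N t x) =
      (localCohomologyCocone I i N).ι.app (op (op t)) x :=
  congrArg ((localCohomologyCocone I i N).ι.app (op (op t))).hom
    ((localCohomologySystemEquiv I i N t).symm_apply_apply x)

lemma toLocalCoh_precomp (I : Ideal A) (i : ℕ) (N : Type u) [AddCommGroup N]
    [Module A N] {s t : ℕ} (hst : s ≤ t) (x : ModExt A (A ⧸ I ^ s) N i) :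
    toLocalCoh I i N t (ModExt.precomp N
      (Submodule.factor (Ideal.pow_le_pow_right hst : I ^ t ≤ I ^ s)) i x) =
      toLocalCoh I i N s x := by
  obtain ⟨x, rfl⟩ := (localCohomologySystemEquiv I i N s).surjective x
  let f : op (op s) ⟶ op (op t) := (homOfLE hst).op.op
  rw [← localCohomologySystemEquiv_map I i N f hst, toLocalCoh_localCohomologySystemEquiv,
    toLocalCoh_localCohomologySystemEquiv]
  exact ConcreteCategory.congr_hom ((localCohomologyCocone I i N).w f) x

lemma toLocalCoh_factor (I : Ideal A) (i : ℕ) (N : Type u) [AddCommGroup N] [Module A N] (t : ℕ)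
    (x : ModExt A (A ⧸ I) N i) :
    toLocalCoh I i N 1 (ModExt.precomp N (Submodule.factor (Ideal.pow_le_self one_ne_zero)) i x) =
      toLocalCoh I i N (t + 1)
        (ModExt.precomp N (Submodule.factor (Ideal.pow_le_self (Nat.succ_ne_zero t))) i x) := by
  rw [← toLocalCoh_precomp I i N (Nat.le_add_left 1 t), ← ModExt.precomp_comp,
    Submodule.factor_comp]

lemma exists_toLocalCoh_eq (I : Ideal A) (i : ℕ) (N : Type u) [AddCommGroup N]
    [Module A N] (x : LocalCoh I i N) : ∃ t y, toLocalCoh I i N t y = x := by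
  obtain ⟨t, y, hy⟩ := Concrete.isColimit_exists_rep _ (localCohomologyIsColimit I i N) x
  exact ⟨t.unop.unop, localCohomologySystemEquiv I i N t.unop.unop y,
    (toLocalCoh_localCohomologySystemEquiv I i N t.unop.unop y).trans hy⟩

lemma exists_precomp_eq_zero_of_toLocalCoh_eq_zero (I : Ideal A) (i : ℕ) (N : Type u)
    [AddCommGroup N] [Module A N] {s : ℕ} (x : ModExt A (A ⧸ I ^ s) N i)
    (hx : toLocalCoh I i N s x = 0) : ∃ (t : ℕ) (hst : s ≤ t), ModExt.precomp N
      (Submodule.factor (Ideal.pow_le_pow_right hst : I ^ t ≤ I ^ s)) i x = 0 := by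
  obtain ⟨x, rfl⟩ := (localCohomologySystemEquiv I i N s).surjective x
  rw [toLocalCoh_localCohomologySystemEquiv] at hx
  obtain ⟨t, f, g, h⟩ := Concrete.isColimit_exists_of_rep_eq _ (localCohomologyIsColimit I i N)
    (i := op (op s)) (j := op (op s)) x 0 (hx.trans (map_zero _).symm)
  refine ⟨t.unop.unop, le_of_op_op_hom f, ?_⟩
  rw [← localCohomologySystemEquiv_map I i N f (le_of_op_op_hom f)]
  refine (congrArg _ (h.trans (map_zero _))).trans (map_zero _)

variable [IsNoetherianRing A] (m : Ideal A) [m.IsMaximal] (i : ℕ) (N : Type u) [AddCommGroup N]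
  [Module A N]

/-- Local cohomology vanishes below the depth. -/
theorem subsingleton_localCoh (h : Subsingleton (ModExt A (A ⧸ m) N i)) :
    Subsingleton (LocalCoh m i N) := by
  refine subsingleton_of_forall_eq 0 fun x ↦ ?_
  obtain ⟨t, y, rfl⟩ := exists_toLocalCoh_eq m i N x
  have := ModExt.subsingleton_of_pow_torsion m i h (A ⧸ m ^ t) t fun a ha z ↦ by
    obtain ⟨c, rfl⟩ := Submodule.Quotient.mk_surjective _ z
    rw [← Submodule.Quotient.mk_smul, Submodule.Quotient.mk_eq_zero]
    exact Ideal.mul_mem_right _ _ ha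
  rw [Subsingleton.elim y 0, map_zero]

/-- In the lowest degree, the socle of local cohomology is an `Ext` of the residue field. -/
theorem nonempty_socle_localCoh_equiv (h : ∀ l < i, Subsingleton (ModExt A (A ⧸ m) N l)) :
    Nonempty (socle m (LocalCoh m i N) ≃ₗ[A] ModExt A (A ⧸ m) N i) := by
  -- Injective transition maps in a directed system give injective maps to the colimit.
  have hinj (s : ℕ) : Function.Injective (toLocalCoh m i N s) := by
    rw [injective_iff_map_eq_zero]
    intro x hx
    obtain ⟨t, hst, h0⟩ := exists_precomp_eq_zero_of_toLocalCoh_eq_zero m i N x hx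
    exact ModExt.precomp_factor_injective m hst i h (h0.trans (map_zero _).symm)
  have htors (a : A) (ha : a ∈ m) (z : A ⧸ m ^ 1) : a • z = 0 := by
    obtain ⟨c, rfl⟩ := Submodule.Quotient.mk_surjective _ z
    rw [← Submodule.Quotient.mk_smul, Submodule.Quotient.mk_eq_zero, pow_one]
    exact Ideal.mul_mem_right _ _ ha
  let φ : ModExt A (A ⧸ m ^ 1) N i →ₗ[A] socle m (LocalCoh m i N) :=
    (toLocalCoh m i N 1).codRestrict _ fun x ↦ by
      rw [Submodule.mem_torsionBySet_iff]
      rintro ⟨a, ha⟩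
      rw [← map_smul, ModExt.smul_eq_zero (htors a ha), map_zero]
  have hφ : Function.Bijective φ := by
    constructor
    · intro x y hxy
      exact hinj 1 (congrArg Subtype.val hxy)
    · rintro ⟨x, hx⟩
      obtain ⟨t, y, rfl⟩ := exists_toLocalCoh_eq m i N x
      rw [Submodule.mem_torsionBySet_iff] at hx
      -- The level t may be 0, where A/m^t = 0 does not map onto A/m; the representative is moved up
      -- to level t + 1.
      rw [← toLocalCoh_precomp m i N (Nat.le_succ t)] at hx
      obtain ⟨z, hz⟩ := ModExt.exists_precomp_factor_eq m (Nat.succ_ne_zero t) i h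
        (ModExt.precomp N (Submodule.factor (Ideal.pow_le_pow_right (Nat.le_succ t))) i y)
        fun a ha ↦ hinj (t + 1) (by rw [map_smul, map_zero]; exact hx ⟨a, ha⟩)
      refine ⟨ModExt.precomp N (Submodule.factor (Ideal.pow_le_self one_ne_zero)) i z,
        Subtype.ext ?_⟩
      change toLocalCoh m i N 1 _ = toLocalCoh m i N t y
      rw [← toLocalCoh_precomp m i N (Nat.le_succ t), ← hz, toLocalCoh_factor]
  exact ⟨(LinearEquiv.ofBijective φ hφ).symm ≪≫ₗ
    ModExt.congrLeft N (Submodule.quotEquivOfEq _ _ (pow_one m).symm) i⟩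

end LocalCohomologySocle

/-! ### Rees's theorem: Ext along a regular sequence. -/

section Rees

open CategoryTheory Limits Opposite Abelian RingTheory.Sequence
open scoped Pointwise

variable {A : Type u} [CommRing A]

section

variable {N M M' M'' : Type u} [AddCommGroup N] [Module A N] [AddCommGroup M] [Module A M]
  [AddCommGroup M'] [Module A M'] [AddCommGroup M''] [Module A M'']
  {f : M →ₗ[A] M'} {g : M' →ₗ[A] M''} (hf : Function.Injective f)
  (hg : Function.Surjective g) (h : Function.Exact f g)

variable (N) in
/-- The connecting homomorphism of the long exact sequence of `Ext` in the second variable. -/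
noncomputable def ModExt.connecting (i : ℕ) : ModExt A N M'' i →ₗ[A] ModExt A N M (i + 1) where
  toFun x := x.comp (shortExact_of_modules hf hg h).extClass rfl
  map_add' x y := by simp
  map_smul' r x := by simp

lemma ModExt.exists_connecting_eq (i : ℕ) (x : ModExt A N M (i + 1))
    (hx : ModExt.postcomp N f (i + 1) x = 0) : ∃ y, ModExt.connecting N hf hg h i y = x :=
  Ext.covariant_sequence_exact₁ _ (shortExact_of_modules hf hg h) x hx rfl

lemma ModExt.exists_postcomp_eq_of_connecting_eq_zero (i : ℕ) (x : ModExt A N M'' i)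
    (hx : ModExt.connecting N hf hg h i x = 0) : ∃ y, ModExt.postcomp N g i y = x :=
  Ext.covariant_sequence_exact₃ _ (shortExact_of_modules hf hg h) x rfl hx

lemma ModExt.connecting_injective (i : ℕ) (h0 : Subsingleton (ModExt A N M' i)) :
    Function.Injective (ModExt.connecting N hf hg h i) := by
  rw [injective_iff_map_eq_zero]
  intro x hx
  obtain ⟨y, rfl⟩ := ModExt.exists_postcomp_eq_of_connecting_eq_zero hf hg h i x hx
  rw [Subsingleton.elim y 0, map_zero]

include hf hg h in
lemma ModExt.subsingleton_right_of_exact (i : ℕ) (h1 : Subsingleton (ModExt A N M' i))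
    (h2 : Subsingleton (ModExt A N M (i + 1))) : Subsingleton (ModExt A N M'' i) :=
  (ModExt.connecting_injective (N := N) hf hg h i h1).subsingleton

end

lemma IsSMulRegular.exact_lsmul {M : Type u} [AddCommGroup M] [Module A M] (r : A) :
    Function.Exact (r • (LinearMap.id : M →ₗ[A] M)) (Submodule.mkQ (r • (⊤ : Submodule A M))) := by
  intro x
  rw [Submodule.mkQ_apply, Submodule.Quotient.mk_eq_zero, Submodule.mem_smul_pointwise_iff_exists]
  simp

variable (N : Type u) [AddCommGroup N] [Module A N]

/-- The connecting homomorphism for multiplication by a regular element. -/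
noncomputable def ModExt.connectingOfRegular {M : Type u} [AddCommGroup M] [Module A M] {r : A}
    (hr : IsSMulRegular M r) (i : ℕ) : ModExt A N (QuotSMulTop r M) i →ₗ[A] ModExt A N M (i + 1) :=
  ModExt.connecting N (f := r • LinearMap.id) (g := (r • (⊤ : Submodule A M)).mkQ)
    (fun _ _ h ↦ hr h) (Submodule.mkQ_surjective _) (IsSMulRegular.exact_lsmul r) i

variable {N}

/-- As r kills N it acts as zero on Ext(N, M), so the long exact sequence of multiplication by r on
M makes the connecting map surjective. -/
lemma ModExt.connectingOfRegular_surjective {M : Type u} [AddCommGroup M] [Module A M] {r : A}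
    (hr : IsSMulRegular M r) (hN : ∀ n : N, r • n = 0) (i : ℕ) :
    Function.Surjective (ModExt.connectingOfRegular N hr i) := fun x ↦
  ModExt.exists_connecting_eq (g := (r • (⊤ : Submodule A M)).mkQ) (fun _ _ h ↦ hr h)
    (Submodule.mkQ_surjective _) (IsSMulRegular.exact_lsmul r) i x
    ((ModExt.postcomp_smul_id r (i + 1) x).trans (ModExt.smul_eq_zero hN _ _))

lemma ModExt.connectingOfRegular_injective {M : Type u} [AddCommGroup M] [Module A M] {r : A}
    (hr : IsSMulRegular M r) (i : ℕ) (h0 : Subsingleton (ModExt A N M i)) :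
    Function.Injective (ModExt.connectingOfRegular N hr i) :=
  ModExt.connecting_injective (g := (r • (⊤ : Submodule A M)).mkQ) (fun _ _ h ↦ hr h)
    (Submodule.mkQ_surjective _) (IsSMulRegular.exact_lsmul r) i h0

/-- In degree 0 a homomorphism from N takes values killed by a regular element. In higher degrees
the connecting map from Ext^i(N, M/rM) is onto, and the sequence is one term shorter on M/rM. -/
theorem ModExt.subsingleton_of_isWeaklyRegular {M : Type u} [AddCommGroup M] [Module A M]
    {rs : List A} (reg : IsWeaklyRegular M rs) (hN : ∀ r ∈ rs, ∀ n : N, r • n = 0) (i : ℕ)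
    (hi : i < rs.length) : Subsingleton (ModExt A N M i) := by
  induction rs generalizing M i with
  | nil => simp at hi
  | cons r rs ih =>
    rw [isWeaklyRegular_cons_iff] at reg
    rw [List.forall_mem_cons] at hN
    cases i with
    | zero =>
      refine (ModExt.zeroEquiv N M).toEquiv.subsingleton_congr.mpr
        (subsingleton_of_forall_eq 0 fun φ ↦ LinearMap.ext fun n ↦ reg.1 ?_)
      change r • φ n = r • 0
      rw [← map_smul, hN.1, map_zero, smul_zero]
    | succ i =>
      have := ih reg.2 hN.2 i (by simpa using hi)
      exact (ModExt.connectingOfRegular_surjective reg.1 hN.1 i).subsingleton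

/-- Each term of the sequence lowers the degree by one, the connecting map being injective because
Ext(N, M) vanishes one degree below. Nothing requires M/(rs)M ≠ 0. -/
theorem ModExt.nonempty_equiv_of_isWeaklyRegular {M : Type u} [AddCommGroup M] [Module A M]
    {rs : List A} (reg : IsWeaklyRegular M rs) (hN : ∀ r ∈ rs, ∀ n : N, r • n = 0) :
    Nonempty (ModExt A N M rs.length ≃ₗ[A] (N →ₗ[A] M ⧸ (Ideal.ofList rs • ⊤ : Submodule A M))) := by
  induction rs generalizing M with
  | nil =>
    have h0 : (Ideal.ofList ([] : List A) • ⊤ : Submodule A M) = ⊥ := by simp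
    exact ⟨ModExt.zeroEquiv N M ≪≫ₗ
      LinearEquiv.congrRight (Submodule.quotEquivOfEqBot _ h0).symm⟩
  | cons r rs ih =>
    have reg' := reg
    rw [isWeaklyRegular_cons_iff] at reg
    have hN' := List.forall_mem_cons.mp hN
    obtain ⟨e⟩ := ih reg.2 hN'.2
    have hb : Function.Bijective (ModExt.connectingOfRegular N reg.1 rs.length) :=
      ⟨ModExt.connectingOfRegular_injective reg.1 _
        (ModExt.subsingleton_of_isWeaklyRegular reg' hN _ (by simp)),
        ModExt.connectingOfRegular_surjective reg.1 hN'.1 _⟩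
    exact ⟨(LinearEquiv.ofBijective _ hb).symm ≪≫ₗ e ≪≫ₗ LinearEquiv.congrRight
      (Submodule.quotOfListConsSMulTopEquivQuotSMulTopInner M r rs).symm⟩

end Rees

/-! ### Regular local rings: quotients, integrality and regular generating sequences. -/

section RegularLocal

open IsLocalRing RingTheory.Sequence
open scoped Pointwise

variable {B : Type u} [CommRing B]

lemma isLocalRing_quotient_span_singleton [IsLocalRing B] {x : B} (hx : x ∈ maximalIdeal B) :
    IsLocalRing (B ⧸ Ideal.span {x}) :=
  have : Nontrivial (B ⧸ Ideal.span {x}) := Ideal.Quotient.nontrivial_iff.mpr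
    fun h ↦ (maximalIdeal.isMaximal B).ne_top (top_le_iff.mp
      (h ▸ (Ideal.span_singleton_le_iff_mem _).mpr hx))
  IsLocalRing.of_surjective' (Ideal.Quotient.mk _) Ideal.Quotient.mk_surjective

lemma maximalIdeal_quotient_span_singleton [IsLocalRing B] {x : B} (hx : x ∈ maximalIdeal B)
    [IsLocalRing (B ⧸ Ideal.span {x})] :
    maximalIdeal (B ⧸ Ideal.span {x}) =
      (maximalIdeal B).map (Ideal.Quotient.mk (Ideal.span {x})) := by
  refine (IsLocalRing.eq_maximalIdeal ?_).symm
  refine (Ideal.map_eq_top_or_isMaximal_of_surjective _ Ideal.Quotient.mk_surjective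
    (maximalIdeal.isMaximal B)).resolve_left fun h ↦ ?_
  have h2 := congrArg (Ideal.comap (Ideal.Quotient.mk (Ideal.span {x}))) h
  rw [Ideal.comap_map_of_surjective _ Ideal.Quotient.mk_surjective, Ideal.comap_top,
    ← RingHom.ker_eq_comap_bot, Ideal.mk_ker,
    sup_eq_left.mpr ((Ideal.span_singleton_le_iff_mem _).mpr hx)] at h2
  exact (maximalIdeal.isMaximal B).ne_top h2

/-- An element outside the square of the maximal ideal is nonzero in the cotangent space. Extend it
to a basis there and lift; Nakayama makes the lifts generate. -/
lemma exists_span_eq_maximalIdeal [IsLocalRing B] [IsNoetherianRing B] {x : B}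
    (hx : x ∈ maximalIdeal B) (hx2 : x ∉ maximalIdeal B ^ 2) :
    ∃ s : Set B, s.Finite ∧ s.ncard + 1 ≤ (maximalIdeal B).spanFinrank ∧
      Ideal.span (insert x s) = maximalIdeal B := by
  classical
  let v : CotangentSpace B := (maximalIdeal B).toCotangent ⟨x, hx⟩
  have hv : v ≠ 0 := fun h ↦ hx2 ((Ideal.toCotangent_eq_zero _ _).mp h)
  have hli : LinearIndepOn (ResidueField B) id {v} :=
    LinearIndepOn.singleton hv
  let b := Module.Basis.extend hli
  let T := hli.extend (Set.subset_univ _)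
  have hvT : v ∈ T := hli.subset_extend _ rfl
  have hfin : T.Finite :=
    have : Finite T := Module.Finite.finite_basis b
    Set.toFinite T
  have hcard : T.ncard = (maximalIdeal B).spanFinrank := by
    rw [spanFinrank_maximalIdeal_eq_finrank_cotangentSpace, Module.finrank_eq_nat_card_basis b]
    rfl
  let l : CotangentSpace B → maximalIdeal B := fun t ↦
    if t = v then ⟨x, hx⟩ else ((maximalIdeal B).toCotangent_surjective t).choose
  have hl (t) : (maximalIdeal B).toCotangent (l t) = t := by
    by_cases h : t = v
    · simp only [l, h, if_true]; rfl
    · simp only [l, h, if_false]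
      exact ((maximalIdeal B).toCotangent_surjective t).choose_spec
  have hspan : Submodule.span B (l '' T) = ⊤ := by
    rw [← CotangentSpace.span_image_eq_top_iff, ← Set.image_comp]
    have : (maximalIdeal B).toCotangent ∘ l = id := funext hl
    rw [this, Set.image_id]
    have := b.span_eq
    rwa [Module.Basis.range_extend] at this
  refine ⟨(fun t ↦ (l t : B)) '' (T \ {v}), (hfin.sdiff).image _, ?_, ?_⟩
  · rw [← hcard, ← Set.ncard_sdiff_singleton_add_one hvT hfin]
    exact Nat.add_le_add_right (Set.ncard_image_le hfin.sdiff) 1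
  · have h1 : insert x ((fun t ↦ (l t : B)) '' (T \ {v})) = (maximalIdeal B).subtype '' (l '' T) := by
      rw [← Set.image_comp]
      have : x = (fun t ↦ (l t : B)) v := by simp [l]
      conv_lhs => rw [this]
      refine (Set.image_insert_eq (f := fun t ↦ (l t : B)) (a := v) (s := T \ {v})).symm.trans ?_
      rw [Set.insert_sdiff_singleton, Set.insert_eq_of_mem hvT]
      rfl
    rw [h1, Ideal.span, ← Submodule.map_span, hspan, Submodule.map_top, Submodule.range_subtype]

lemma spanFinrank_maximalIdeal_quotient_add_one_le [IsLocalRing B] [IsNoetherianRing B] {x : B}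
    (hx : x ∈ maximalIdeal B) (hx2 : x ∉ maximalIdeal B ^ 2) [IsLocalRing (B ⧸ Ideal.span {x})] :
    (maximalIdeal (B ⧸ Ideal.span {x})).spanFinrank + 1 ≤ (maximalIdeal B).spanFinrank := by
  obtain ⟨s, hs, hcard, hspan⟩ := exists_span_eq_maximalIdeal hx hx2
  refine le_trans (Nat.add_le_add_right ?_ 1) hcard
  have h1 : maximalIdeal (B ⧸ Ideal.span {x}) =
      Ideal.span (Ideal.Quotient.mk (Ideal.span {x}) '' s) := by
    rw [maximalIdeal_quotient_span_singleton hx, ← hspan, Ideal.map_span, Set.image_insert_eq]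
    rw [Ideal.Quotient.eq_zero_iff_mem.mpr (Ideal.mem_span_singleton_self x), Ideal.span_insert]
    simp
  rw [h1]
  exact (Submodule.spanFinrank_span_le_ncard_of_finite (hs.image _)).trans (Set.ncard_image_le hs)

/-- The quotient of a regular local ring by an element outside the square of the maximal ideal
is a regular local ring. -/
lemma IsRegularLocalRing.quotient_span_singleton [IsRegularLocalRing B] {x : B}
    (hx : x ∈ maximalIdeal B) (hx2 : x ∉ maximalIdeal B ^ 2) :
    IsRegularLocalRing (B ⧸ Ideal.span {x}) := by
  have := isLocalRing_quotient_span_singleton hx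
  refine IsRegularLocalRing.of_spanFinrank_maximalIdeal_le _ ?_
  have h2 := spanFinrank_maximalIdeal_quotient_add_one_le hx hx2
  -- The dimension drops by at most one, while the embedding dimension drops by at least one.
  have h3 : ringKrullDim B ≤ ringKrullDim (B ⧸ Ideal.span {x}) + 1 := by
    have h := ringKrullDim_le_ringKrullDim_quotSMulTop_succ hx
    have e : x • (⊤ : Ideal B) = Ideal.span {x} := by simp [← Submodule.ideal_span_singleton_smul]
    rwa [e] at h
  rw [← IsRegularLocalRing.spanFinrank_maximalIdeal (R := B)] at h3
  have h4 : (((maximalIdeal (B ⧸ Ideal.span {x})).spanFinrank : ℕ) : WithBot ℕ∞) + 1 ≤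
      ringKrullDim (B ⧸ Ideal.span {x}) + 1 := le_trans (by exact_mod_cast h2) h3
  generalize ringKrullDim (B ⧸ Ideal.span {x}) = D at h4
  cases D using WithBot.recBotCoe with
  | bot => simp at h4
  | coe D =>
    cases D using ENat.recTopCoe with
    | top => exact le_top
    | coe D => exact_mod_cast Nat.le_of_add_le_add_right (by exact_mod_cast h4)

lemma IsRegularLocalRing.ringKrullDim_quotient_span_singleton_add_one [IsRegularLocalRing B] {x : B}
    (hx : x ∈ maximalIdeal B) (hx2 : x ∉ maximalIdeal B ^ 2) :
    ringKrullDim (B ⧸ Ideal.span {x}) + 1 ≤ ringKrullDim B := by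
  have := IsRegularLocalRing.quotient_span_singleton hx hx2
  have h2 := spanFinrank_maximalIdeal_quotient_add_one_le hx hx2
  rw [← IsRegularLocalRing.spanFinrank_maximalIdeal (R := B),
    ← IsRegularLocalRing.spanFinrank_maximalIdeal (R := B ⧸ Ideal.span {x})]
  exact_mod_cast h2

/-- A regular local ring is a domain. -/
theorem IsRegularLocalRing.isDomain (B : Type u) [CommRing B] [IsRegularLocalRing B] :
    IsDomain B := by
  generalize hn : (maximalIdeal B).spanFinrank = n
  induction n using Nat.strong_induction_on generalizing B with
  | _ n ih =>
  by_cases hm : maximalIdeal B = ⊥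
  · exact (isField_iff_maximalIdeal_eq.mpr hm).isDomain
  have hm2 : ¬ maximalIdeal B ≤ maximalIdeal B ^ 2 := fun h ↦ hm <|
    Submodule.eq_bot_of_le_smul_of_le_jacobson_bot (maximalIdeal B) (maximalIdeal B)
      (IsNoetherian.noetherian _) (by rwa [smul_eq_mul, ← sq])
      (maximalIdeal_le_jacobson _)
  -- If the maximal ideal were a minimal prime, the dimension and so the embedding dimension would
  -- be 0.
  have hmin (p : Ideal B) (hp : p ∈ minimalPrimes B) : ¬ maximalIdeal B ≤ p := by
    intro hle
    have := hp.1.1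
    have h0 : ringKrullDim B = 0 := by
      rw [← maximalIdeal_height_eq_ringKrullDim,
        ← (maximalIdeal.isMaximal B).eq_of_le hp.1.1.ne_top hle |>.symm,
        Ideal.height_eq_zero_iff.mpr hp]
      rfl
    rw [← IsRegularLocalRing.spanFinrank_maximalIdeal (R := B)] at h0
    exact hm ((Submodule.spanFinrank_eq_zero_iff_eq_bot (IsNoetherian.noetherian _)).mp
      (by exact_mod_cast h0))
  -- Prime avoidance; the square of the maximal ideal is the only member that need not be prime.
  obtain ⟨x, hx, hx'⟩ : ∃ x ∈ maximalIdeal B,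
      x ∉ ⋃ p ∈ insert (maximalIdeal B ^ 2) (minimalPrimes B), (p : Set B) := by
    by_contra! h
    obtain ⟨p, hp, hle⟩ := (Ideal.subset_union_prime_finite
      ((minimalPrimes.finite_of_isNoetherianRing B).insert (maximalIdeal B ^ 2)) (f := id)
      (maximalIdeal B ^ 2) (maximalIdeal B ^ 2)
      (fun p hp h1 _ ↦ (hp.resolve_left h1).1.1)).mp h
    rcases hp with rfl | hp
    · exact hm2 hle
    · exact hmin p hp hle
  simp only [Set.mem_insert_iff, Set.iUnion_iUnion_eq_or_left, Set.mem_union, SetLike.mem_coe,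
    Set.mem_iUnion, not_or, not_exists] at hx'
  have := IsRegularLocalRing.quotient_span_singleton hx hx'.1
  have hlt : (maximalIdeal (B ⧸ Ideal.span {x})).spanFinrank < n := by
    have := IsRegularLocalRing.ringKrullDim_quotient_span_singleton_add_one hx hx'.1
    rw [← IsRegularLocalRing.spanFinrank_maximalIdeal (R := B),
      ← IsRegularLocalRing.spanFinrank_maximalIdeal (R := B ⧸ Ideal.span {x}), hn] at this
    exact Nat.lt_of_succ_le (by exact_mod_cast this)
  have hdom := ih _ hlt (B ⧸ Ideal.span {x}) rfl
  have hprime : (Ideal.span {x}).IsPrime := (Ideal.Quotient.isDomain_iff_prime _).mp hdom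
  obtain ⟨p, hp, hpx⟩ := Ideal.exists_minimalPrimes_le (bot_le : ⊥ ≤ Ideal.span {x})
  have hxp : x ∉ p := hx'.2 p hp
  have := hp.1.1
  -- The quotient by x is a domain by induction, so (x) is prime and contains a minimal prime p.
  -- Since x ∉ p, every element of p is x times an element of p, and Nakayama gives p = 0.
  have hpbot : p = ⊥ := by
    refine Submodule.eq_bot_of_le_smul_of_le_jacobson_bot (maximalIdeal B) p
      (IsNoetherian.noetherian _) (fun y hy ↦ ?_) (maximalIdeal_le_jacobson _)
    obtain ⟨z, rfl⟩ := Ideal.mem_span_singleton'.mp (hpx hy)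
    rw [mul_comm]
    exact Submodule.smul_mem_smul hx ((hp.1.1.mem_or_mem hy).resolve_right hxp)
  rw [hpbot] at this
  exact IsDomain.of_bot_isPrime B

/-- The maximal ideal of a regular local ring is generated by a regular sequence whose elements
can be chosen in any given generating set. -/
theorem IsRegularLocalRing.exists_isWeaklyRegular (B : Type u) [CommRing B] [IsRegularLocalRing B]
    (S : Set B) (hS : Ideal.span S = maximalIdeal B) :
    ∃ rs : List B, (∀ r ∈ rs, r ∈ S) ∧ (rs.length : WithBot ℕ∞) = ringKrullDim B ∧
      Ideal.ofList rs = maximalIdeal B ∧ IsWeaklyRegular B rs := by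
  rw [← IsRegularLocalRing.spanFinrank_maximalIdeal (R := B)]
  simp only [Nat.cast_inj]
  generalize hn : (maximalIdeal B).spanFinrank = n
  induction n using Nat.strong_induction_on generalizing B with
  | _ n ih =>
  by_cases hm : maximalIdeal B = ⊥
  · refine ⟨[], by simp, ?_, by simp [hm], IsWeaklyRegular.nil _ _⟩
    rw [← hn, hm]; simp
  -- If all of S lay in the square of the maximal ideal, so would the maximal ideal, against
  -- Nakayama.
  obtain ⟨x, hxS, hx2⟩ : ∃ x ∈ S, x ∉ maximalIdeal B ^ 2 := by
    by_contra! h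
    refine hm (Submodule.eq_bot_of_le_smul_of_le_jacobson_bot (maximalIdeal B) (maximalIdeal B)
      (IsNoetherian.noetherian _) ?_ (maximalIdeal_le_jacobson _))
    rw [smul_eq_mul, ← sq]
    conv_lhs => rw [← hS]
    exact Ideal.span_le.mpr h
  have hx : x ∈ maximalIdeal B := hS ▸ Ideal.subset_span hxS
  have hreg := IsRegularLocalRing.quotient_span_singleton hx hx2
  have hdom := IsRegularLocalRing.isDomain B
  have hx0 : x ≠ 0 := fun h ↦ hx2 (h ▸ zero_mem _)
  let π := Ideal.Quotient.mk (Ideal.span {x})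
  have hdim : (maximalIdeal (B ⧸ Ideal.span {x})).spanFinrank + 1 = n := by
    have := ringKrullDim_quotient_span_singleton_succ_eq_ringKrullDim_of_mem_nonZeroDivisors
      (mem_nonZeroDivisors_of_ne_zero hx0) hx
    rw [← IsRegularLocalRing.spanFinrank_maximalIdeal (R := B),
      ← IsRegularLocalRing.spanFinrank_maximalIdeal (R := B ⧸ Ideal.span {x}), hn] at this
    exact_mod_cast this
  obtain ⟨rs', hrs', hlen, hspan, hw⟩ := ih _ (by omega) (B ⧸ Ideal.span {x}) (π '' S) (by
    rw [← Ideal.map_span, hS, maximalIdeal_quotient_span_singleton hx]) rfl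
  obtain ⟨rs, hrs, rfl⟩ : ∃ rs : List B, (∀ r ∈ rs, r ∈ S) ∧ rs.map π = rs' := by
    clear hlen hspan hw
    induction rs' with
    | nil => exact ⟨[], by simp, rfl⟩
    | cons a as ih =>
      rw [List.forall_mem_cons] at hrs'
      obtain ⟨⟨s, hs, rfl⟩, h2⟩ := hrs'
      obtain ⟨rs, h3, rfl⟩ := ih h2
      exact ⟨s :: rs, by simpa [hs] using h3, rfl⟩
  refine ⟨x :: rs, by simpa [hxS] using hrs, by simpa [← hdim] using hlen, ?_, ?_⟩
  · rw [maximalIdeal_quotient_span_singleton hx, ← Ideal.map_ofList] at hspan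
    have h2 := congrArg (Ideal.comap π) hspan
    rw [Ideal.comap_map_of_surjective _ Ideal.Quotient.mk_surjective,
      Ideal.comap_map_of_surjective _ Ideal.Quotient.mk_surjective, ← RingHom.ker_eq_comap_bot,
      Ideal.mk_ker, sup_eq_left.mpr ((Ideal.span_singleton_le_iff_mem _).mpr hx)] at h2
    rw [Ideal.ofList_cons, sup_comm, h2]
  · rw [isWeaklyRegular_cons_iff]
    refine ⟨fun a b h ↦ mul_left_cancel₀ hx0 h, ?_⟩
    have e : x • (⊤ : Ideal B) = Ideal.span {x} := by simp [← Submodule.ideal_span_singleton_smul]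
    let E : QuotSMulTop x B ≃ₗ[B] B ⧸ Ideal.span {x} := Submodule.quotEquivOfEq _ _ e
    rw [E.isWeaklyRegular_congr]
    exact (isWeaklyRegular_map_algebraMap_iff (B ⧸ Ideal.span {x}) (B ⧸ Ideal.span {x}) rs).mp hw

end RegularLocal

/-! ### Smooth algebras over a field are regular. -/

section SmoothRegular

open IsLocalRing

/-- Generators of the maximal ideal of S generate that of T, so the embedding dimension does not
grow; flatness gives going down, so the dimension does not fall. -/
theorem IsRegularLocalRing.of_flat_of_map_maximalIdeal {S T : Type*} [CommRing S] [CommRing T]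
    [IsRegularLocalRing S] [IsLocalRing T] [IsNoetherianRing T] [Algebra S T]
    [IsLocalHom (algebraMap S T)] [Module.Flat S T]
    (h : (maximalIdeal S).map (algebraMap S T) = maximalIdeal T) : IsRegularLocalRing T := by
  refine IsRegularLocalRing.of_spanFinrank_maximalIdeal_le _ ?_
  have h1 : (maximalIdeal T).spanFinrank ≤ (maximalIdeal S).spanFinrank := by
    rw [← h]; exact Ideal.spanFinrank_map_le_of_fg _ (IsNoetherian.noetherian _)
  have h2 : (maximalIdeal S).height ≤ (maximalIdeal T).height := by
    rw [Ideal.height_eq_height_add_of_liesOver_of_hasGoingDown (maximalIdeal S) (maximalIdeal T)]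
    exact le_self_add
  rw [← IsLocalRing.maximalIdeal_height_eq_ringKrullDim (R := T)]
  refine le_trans ?_ (WithBot.coe_le_coe.mpr h2)
  rw [IsLocalRing.maximalIdeal_height_eq_ringKrullDim, ← IsRegularLocalRing.spanFinrank_maximalIdeal]
  exact_mod_cast h1

/-- The local homomorphisms are flat and unramified, so the maximal ideal downstairs generates the
one upstairs. -/
theorem IsRegularRing.of_etale (S T : Type*) [CommRing S] [CommRing T] [Algebra S T]
    [IsRegularRing S] [Algebra.Etale S T] : IsRegularRing T := by
  have : IsNoetherianRing T := Algebra.FiniteType.isNoetherianRing S T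
  refine isRegularRing_iff.mpr fun Q _ ↦ ?_
  let := Localization.AtPrime.algebraOfLiesOver (Q.under S) Q
  have : IsLocalHom (algebraMap (Localization.AtPrime (Q.under S)) (Localization.AtPrime Q)) :=
    Localization.isLocalHom_localRingHom (Q.under S) Q (algebraMap S T) Ideal.LiesOver.over
  have : Algebra.FormallyUnramified T (Localization.AtPrime Q) :=
    .of_isLocalization Q.primeCompl
  have : Algebra.FormallyUnramified S (Localization.AtPrime Q) := .comp S T _
  have : Algebra.FormallyUnramified (Localization.AtPrime (Q.under S)) (Localization.AtPrime Q) :=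
    .of_restrictScalars S _ _
  have : Algebra.EssFiniteType T (Localization.AtPrime Q) := .of_isLocalization _ Q.primeCompl
  have : Algebra.EssFiniteType S (Localization.AtPrime Q) := .comp S T _
  have : Algebra.EssFiniteType (Localization.AtPrime (Q.under S)) (Localization.AtPrime Q) :=
    .of_comp S _ _
  exact .of_flat_of_map_maximalIdeal
    (Algebra.FormallyUnramified.map_maximalIdeal (R := Localization.AtPrime (Q.under S)))

/-- Near every point a smooth algebra is étale over a polynomial ring. -/
theorem IsRegularRing.of_smooth (k : Type*) (R : Type*) [Field k] [CommRing R] [Algebra k R]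
    [Algebra.Smooth k R] : IsRegularRing R := by
  have : IsNoetherianRing R := Algebra.FiniteType.isNoetherianRing k R
  refine isRegularRing_iff.mpr fun Q _ ↦ ?_
  obtain ⟨g, hg, n, _, _, _⟩ :=
    Algebra.IsSmoothAt.exists_isStandardEtale_mvPolynomial (R := k) (p := Q)
  have : IsRegularRing (Localization.Away g) :=
    .of_etale (MvPolynomial (Fin n) k) (Localization.Away g)
  have hd : Disjoint (Submonoid.powers g : Set R) (Q : Set R) :=
    (Ideal.disjoint_powers_iff_notMem_of_isPrime _).mpr hg
  let P := Q.map (algebraMap R (Localization.Away g))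
  have : P.IsPrime := IsLocalization.isPrime_of_isPrime_disjoint (.powers g) _ Q ‹_› hd
  have h := IsLocalization.isLocalization_isLocalization_atPrime_isLocalization
    (M := .powers g) (Localization.AtPrime P) P
  simp_rw [P, IsLocalization.under_map_of_isPrime_disjoint (.powers g) _ ‹_› hd] at h
  exact .of_ringEquiv (IsLocalization.algEquiv Q.primeCompl
    (Localization.AtPrime P) (Localization.AtPrime Q)).toRingEquiv

end SmoothRegular

/-! ### Localization of quotients and of modules killed by a maximal ideal. -/

section LocalizationOfQuotient

open IsLocalRing RingTheory.Sequence
open scoped Pointwise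

/-- Localization commutes with forming the quotient by `I • ⊤`. -/
theorem isLocalizedModule_mapQ_smul_top {R M N : Type*} [CommRing R] [AddCommGroup M] [Module R M]
    [AddCommGroup N] [Module R N] (S : Submonoid R) (f : M →ₗ[R] N) [IsLocalizedModule S f]
    (I : Ideal R) :
    IsLocalizedModule S (Submodule.mapQ (I • ⊤ : Submodule R M) (I • ⊤ : Submodule R N) f
      (Submodule.smul_top_le_comap_smul_top I f)) := by
  -- Up to a denominator, elements of I • N come from I • M.
  have key : ∀ y ∈ (I • ⊤ : Submodule R N), ∃ s : S, ∃ x ∈ (I • ⊤ : Submodule R M),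
      s • y = f x := by
    intro y hy
    induction hy using Submodule.smul_induction_on' with
    | smul r hr n _ =>
      obtain ⟨⟨m, s⟩, hm⟩ := IsLocalizedModule.surj S f n
      refine ⟨s, r • m, Submodule.smul_mem_smul hr trivial, ?_⟩
      rw [map_smul, ← hm, smul_comm]
    | add y _ z _ hy hz =>
      obtain ⟨s, x, hx, h⟩ := hy
      obtain ⟨t, x', hx', h'⟩ := hz
      refine ⟨s * t, t • x + s • x', add_mem (Submodule.smul_of_tower_mem _ _ hx)
        (Submodule.smul_of_tower_mem _ _ hx'), ?_⟩
      simp only [Submonoid.smul_def, map_add, map_smul] at h h' ⊢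
      rw [← h, ← h', smul_add, Submonoid.coe_mul, smul_smul, smul_smul, mul_comm]
  refine ⟨fun s ↦ ?_, fun y ↦ ?_, fun {x y} h ↦ ?_⟩
  · rw [Module.End.isUnit_iff]
    have hs := (Module.End.isUnit_iff _).mp (IsLocalizedModule.map_units f s)
    refine ⟨(injective_iff_map_eq_zero _).mpr fun y hy ↦ ?_, fun y ↦ ?_⟩
    · induction y using Submodule.Quotient.induction_on with | _ y
      rw [Module.algebraMap_end_apply, ← Submodule.Quotient.mk_smul,
        Submodule.Quotient.mk_eq_zero] at hy
      rw [Submodule.Quotient.mk_eq_zero]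
      obtain ⟨e, he⟩ := IsLocalizedModule.map_units f s
      have : y = (e⁻¹).1 ((s : R) • y) := by
        have := LinearMap.congr_fun e.inv_mul y
        rw [he] at this
        exact this.symm
      rw [this]
      exact Submodule.smul_top_le_comap_smul_top I _ hy
    · induction y using Submodule.Quotient.induction_on with | _ y
      obtain ⟨z, rfl⟩ := hs.2 y
      exact ⟨Submodule.Quotient.mk z, rfl⟩
  · induction y using Submodule.Quotient.induction_on with | _ y
    obtain ⟨⟨m, s⟩, hm⟩ := IsLocalizedModule.surj S f y
    refine ⟨⟨Submodule.Quotient.mk m, s⟩, ?_⟩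
    rw [Submodule.mapQ_apply, ← hm]
    rfl
  · induction x using Submodule.Quotient.induction_on with | _ x
    induction y using Submodule.Quotient.induction_on with | _ y
    rw [Submodule.mapQ_apply, Submodule.mapQ_apply, Submodule.Quotient.eq, ← map_sub] at h
    obtain ⟨s, z, hz, h⟩ := key _ h
    rw [Submonoid.smul_def, ← map_smul] at h
    obtain ⟨t, ht⟩ := IsLocalizedModule.exists_of_eq (S := S) h
    refine ⟨t * s, ?_⟩
    change Submodule.Quotient.mk ((t * s) • x) = Submodule.Quotient.mk ((t * s) • y)
    rw [Submodule.Quotient.eq, ← smul_sub, mul_smul]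
    have : t • (s : R) • (x - y) = t • z := ht
    rw [Submonoid.smul_def s, this]
    exact Submodule.smul_of_tower_mem _ _ hz

/-- On modules killed by a maximal ideal, localization at that ideal does nothing. -/
theorem isUnit_algebraMap_end_of_isMaximal {R N : Type*} [CommRing R] [AddCommGroup N] [Module R N]
    (P : Ideal R) [P.IsMaximal] (hN : ∀ a ∈ P, ∀ n : N, a • n = 0) (s : P.primeCompl) :
    IsUnit (algebraMap R (Module.End R N) s) := by
  obtain ⟨t, p, hp, h⟩ := (inferInstance : P.IsMaximal).exists_inv s.2
  have h1 : algebraMap R (Module.End R N) (t * s) = 1 := by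
    ext n
    rw [Module.algebraMap_end_apply, eq_sub_of_add_eq h, sub_smul, hN p hp, one_smul, sub_zero]
    rfl
  have h2 : algebraMap R (Module.End R N) (s * t) = 1 := by rw [mul_comm, h1]
  rw [map_mul] at h1 h2
  exact ⟨⟨_, _, h2, h1⟩, rfl⟩

lemma isLocalizedModule_id_of_isMaximal {R N : Type*} [CommRing R] [AddCommGroup N] [Module R N]
    (P : Ideal R) [P.IsMaximal] (hN : ∀ a ∈ P, ∀ n : N, a • n = 0) :
    IsLocalizedModule P.primeCompl (LinearMap.id : N →ₗ[R] N) :=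
  ⟨isUnit_algebraMap_end_of_isMaximal P hN, fun y ↦ ⟨⟨y, 1⟩, by simp⟩,
    fun {x y} h ↦ ⟨1, by simpa using h⟩⟩

/-- Hom(R/P, ·) commutes with localization as R/P is finitely presented, and Hom(R/P, X) is killed
by P, so it is its own localization. -/
theorem nonempty_linearMap_equiv_of_isLocalizedModule {R X Y : Type*} [CommRing R]
    [IsNoetherianRing R] [AddCommGroup X] [Module R X] [AddCommGroup Y] [Module R Y]
    (P : Ideal R) [P.IsMaximal] (g : X →ₗ[R] Y) [IsLocalizedModule P.primeCompl g] :
    Nonempty (((R ⧸ P) →ₗ[R] X) ≃ₗ[R] ((R ⧸ P) →ₗ[R] Y)) := by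
  have h0 : ∀ a ∈ P, ∀ n : R ⧸ P, a • n = 0 := fun a ha n ↦ by
    rw [Algebra.smul_def, Ideal.Quotient.algebraMap_eq, Ideal.Quotient.eq_zero_iff_mem.mpr ha,
      zero_mul]
  have := isLocalizedModule_id_of_isMaximal P h0
  have := isLocalizedModule_id_of_isMaximal (N := (R ⧸ P) →ₗ[R] X) P fun a ha n ↦ by
    ext; simp [← map_smul, h0 a ha]
  have : Module.FinitePresentation R (R ⧸ P) := Module.finitePresentation_of_finite R _
  exact ⟨IsLocalizedModule.linearEquiv P.primeCompl LinearMap.id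
    (IsLocalizedModule.map P.primeCompl (LinearMap.id : (R ⧸ P) →ₗ[R] (R ⧸ P)) g)⟩

end LocalizationOfQuotient

/-! ### Regular rings are Cohen–Macaulay. -/

section GradeOfPrimes

open IsLocalRing RingTheory.Sequence
open scoped Pointwise

variable {R : Type u} [CommRing R]

/-- At a prime `Q` of a regular ring, `Q R_Q` is generated by a regular sequence from `Q`. -/
theorem exists_isWeaklyRegular_localization [IsRegularRing R] (Q : Ideal R) [Q.IsPrime] :
    ∃ zs : List R, (∀ z ∈ zs, z ∈ Q) ∧ (zs.length : ℕ∞) = Q.height ∧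
      Ideal.ofList (zs.map (algebraMap R (Localization.AtPrime Q))) =
        maximalIdeal (Localization.AtPrime Q) ∧
      IsWeaklyRegular (Localization.AtPrime Q) zs := by
  obtain ⟨rs, hrs, hlen, hspan, hreg⟩ := IsRegularLocalRing.exists_isWeaklyRegular
    (Localization.AtPrime Q) (algebraMap R (Localization.AtPrime Q) '' Q)
    (Localization.AtPrime.map_eq_maximalIdeal (I := Q))
  choose! z hz using hrs
  have h1 : (rs.map z).map (algebraMap R (Localization.AtPrime Q)) = rs := by
    rw [List.map_map]
    exact List.map_congr_left (fun r hr ↦ (hz r hr).2) |>.trans (List.map_id rs)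
  refine ⟨rs.map z, ?_, ?_, ?_, ?_⟩
  · simp only [List.mem_map]
    rintro _ ⟨r, hr, rfl⟩
    exact (hz r hr).1
  · rw [IsLocalization.AtPrime.ringKrullDim_eq_height Q] at hlen
    rw [List.length_map]
    exact_mod_cast hlen
  · rw [h1, hspan]
  · rw [← isWeaklyRegular_map_algebraMap_iff (S := Localization.AtPrime Q), h1]
    exact hreg

/-- A regular sequence on R_Q taken from Q, of length the height of Q, kills R/Q; Rees's theorem
applies. -/
theorem ModExt.subsingleton_of_lt_height [IsRegularRing R] (Q : Ideal R) [Q.IsPrime] (i : ℕ)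
    (hi : (i : ℕ∞) < Q.height) :
    Subsingleton (ModExt R (R ⧸ Q) (Localization.AtPrime Q) i) := by
  obtain ⟨zs, hz, hlen, -, hreg⟩ := exists_isWeaklyRegular_localization Q
  refine ModExt.subsingleton_of_isWeaklyRegular hreg (fun r hr n ↦ ?_) i ?_
  · rw [Algebra.smul_def, Ideal.Quotient.algebraMap_eq,
      Ideal.Quotient.eq_zero_iff_mem.mpr (hz r hr), zero_mul]
  · rw [← hlen] at hi
    exact_mod_cast hi

/-- Regular rings are Cohen–Macaulay: the associated primes of `R / rs` have height at most the
length of the regular sequence `rs`. -/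
theorem height_le_length_of_mem_associatedPrimes [IsRegularRing R] {rs : List R}
    (hrs : IsWeaklyRegular R rs) {Q : Ideal R}
    (hQ : Q ∈ associatedPrimes R (R ⧸ (Ideal.ofList rs • ⊤ : Submodule R R))) :
    Q.height ≤ rs.length := by
  obtain ⟨hp, x, hx⟩ := (Submodule.isAssociatedPrime_iff).mp (AssociatedPrimes.mem_iff.mp hQ)
  have hx' : ∀ r, r ∈ Q ↔ r • x = 0 := fun r ↦ by
    rw [hx, Submodule.mem_colon_singleton, Submodule.mem_bot]
  have hmem : ∀ r ∈ rs, r ∈ Q := fun r hr ↦ by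
    rw [hx']
    induction x using Submodule.Quotient.induction_on with | _ x
    rw [← Submodule.Quotient.mk_smul, Submodule.Quotient.mk_eq_zero]
    exact Submodule.smul_mem_smul (Ideal.subset_span hr) trivial
  by_contra! hlt
  have h0 := ModExt.subsingleton_of_lt_height Q rs.length hlt
  have hreg : IsWeaklyRegular (Localization.AtPrime Q) rs := by
    rw [← isWeaklyRegular_map_algebraMap_iff (S := Localization.AtPrime Q)]
    exact hrs.of_isLocalization _ Q.primeCompl
  -- The Ext group that vanishes for height reasons is also Hom(R/Q, R_Q/(rs)R_Q).
  obtain ⟨e⟩ := ModExt.nonempty_equiv_of_isWeaklyRegular (N := R ⧸ Q) hreg (fun r hr n ↦ by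
    rw [Algebra.smul_def, Ideal.Quotient.algebraMap_eq,
      Ideal.Quotient.eq_zero_iff_mem.mpr (hmem r hr), zero_mul])
  have h1 := e.symm.injective.subsingleton
  have := isLocalizedModule_mapQ_smul_top Q.primeCompl
    (Algebra.linearMap R (Localization.AtPrime Q)) (Ideal.ofList rs)
  set g := Submodule.mapQ (Ideal.ofList rs • ⊤ : Submodule R R)
    (Ideal.ofList rs • ⊤ : Submodule R (Localization.AtPrime Q))
    (Algebra.linearMap R (Localization.AtPrime Q))
    (Submodule.smul_top_le_comap_smul_top _ _)
  -- The embedding R/Q → R/(rs), 1 ↦ x, followed by localization at Q. Its vanishing would provide s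
  -- ∉ Q with s x = 0, although Q is the annihilator of x.
  let φ : (R ⧸ Q) →ₗ[R] _ := g ∘ₗ Submodule.liftQ Q (LinearMap.toSpanSingleton R _ x)
    (fun r hr ↦ (hx' r).mp hr)
  have h2 : φ (Submodule.Quotient.mk 1) = g x :=
    congrArg g (one_smul R x)
  have h3 : g x = g 0 := by
    rw [← h2, Subsingleton.elim φ 0, map_zero]; rfl
  obtain ⟨s, hs⟩ := IsLocalizedModule.exists_of_eq (S := Q.primeCompl) h3
  rw [smul_zero] at hs
  exact s.2 ((hx' _).mpr hs)

/-- In a regular ring, regular sequences in `I` can be extended to length the height of `I`. -/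
theorem exists_isWeaklyRegular_append [IsRegularRing R] (I : Ideal R) (rs : List R)
    (hrs : IsWeaklyRegular R rs) (n : ℕ)
    (hI : ∀ Q : Ideal R, Q.IsPrime → I ≤ Q → ((rs.length + n : ℕ) : ℕ∞) ≤ Q.height) :
    ∃ ts : List R, (∀ t ∈ ts, t ∈ I) ∧ ts.length = n ∧ IsWeaklyRegular R (rs ++ ts) := by
  induction n with
  | zero => exact ⟨[], by simp, rfl, by simpa using hrs⟩
  | succ n ih =>
    obtain ⟨ts, h1, h2, h3⟩ := ih fun Q hQ hIQ ↦ le_trans (by norm_cast; lia) (hI Q hQ hIQ)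
    let M := R ⧸ (Ideal.ofList (rs ++ ts) • ⊤ : Submodule R R)
    obtain ⟨t, ht, hreg⟩ : ∃ t ∈ I, IsSMulRegular M t := by
      -- Otherwise prime avoidance places I inside an associated prime of the quotient, whose height
      -- is at most the length reached so far.
      by_contra! h
      have hsub : (I : Set R) ⊆ ⋃ p ∈ associatedPrimes R M, p := by
        rw [biUnion_associatedPrimes_eq_compl_regular]
        exact fun t ht ↦ h t ht
      have hfin := associatedPrimes.finite R M
      have hsub' : (I : Set R) ⊆ ⋃ p ∈ (hfin.toFinset : Set (Ideal R)), ((id p : Ideal R) : Set R) := by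
        simpa using hsub
      rw [Ideal.subset_union_prime ⊥ ⊥
        (fun p hp _ _ ↦ ((Set.Finite.mem_toFinset _).mp hp).isPrime)] at hsub'
      obtain ⟨Q, hQ, hIQ⟩ := hsub'
      rw [Set.Finite.mem_toFinset] at hQ
      have h4 := (hI Q hQ.isPrime hIQ).trans (height_le_length_of_mem_associatedPrimes h3 hQ)
      rw [List.length_append, h2] at h4
      norm_cast at h4
      lia
    refine ⟨ts ++ [t], ?_, by simp [h2], ?_⟩
    · intro s hs
      rw [List.mem_append, List.mem_singleton] at hs
      rcases hs with hs | rfl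
      exacts [h1 s hs, ht]
    · rw [← List.append_assoc, isWeaklyRegular_append_iff, isWeaklyRegular_singleton_iff]
      exact ⟨h3, hreg⟩

end GradeOfPrimes

/-! ### Hypersurfaces in regular rings: Cohen–Macaulay and Gorenstein properties. -/

section HypersurfaceQuotient

open IsLocalRing RingTheory.Sequence
open scoped Pointwise

variable {R : Type u} [CommRing R] (f : R)

lemma isWeaklyRegular_quotient_map {rs : List R} (h : IsWeaklyRegular R (f :: rs)) :
    IsWeaklyRegular (R ⧸ Ideal.span {f}) (rs.map (Ideal.Quotient.mk (Ideal.span {f}))) := by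
  have h1 : (f • ⊤ : Submodule R R) = Ideal.span {f} := by
    rw [← Submodule.ideal_span_singleton_smul, smul_eq_mul, Ideal.mul_top]
  have h2 := ((Submodule.quotEquivOfEq _ _ h1).isWeaklyRegular_congr rs).mp
    ((isWeaklyRegular_cons_iff R f rs).mp h).2
  exact (isWeaklyRegular_map_algebraMap_iff (S := R ⧸ Ideal.span {f}) _ rs).mpr h2

variable {f}

lemma mem_comap_quotient_span_singleton (p : Ideal (R ⧸ Ideal.span {f})) :
    f ∈ p.comap (Ideal.Quotient.mk (Ideal.span {f})) := by
  rw [Ideal.mem_comap, Ideal.Quotient.eq_zero_iff_mem.mpr (Ideal.mem_span_singleton_self f)]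
  exact zero_mem p

/-- The local ring of `V(f)` at `p` is the quotient of the local ring of the ambient space. -/
theorem nonempty_localization_quotient_ringEquiv (p : Ideal (R ⧸ Ideal.span {f})) [p.IsPrime] :
    Nonempty (Localization.AtPrime p ≃+*
      Localization.AtPrime (p.comap (Ideal.Quotient.mk (Ideal.span {f}))) ⧸
        Ideal.span {algebraMap R (Localization.AtPrime
          (p.comap (Ideal.Quotient.mk (Ideal.span {f})))) f}) := by
  set Q := p.comap (Ideal.Quotient.mk (Ideal.span {f})) with hQ
  have h1 : Algebra.algebraMapSubmonoid (R ⧸ Ideal.span {f}) Q.primeCompl = p.primeCompl := by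
    ext x
    obtain ⟨x, rfl⟩ := Ideal.Quotient.mk_surjective x
    refine ⟨?_, fun h ↦ ⟨x, h, rfl⟩⟩
    rintro ⟨y, hy, h⟩
    rw [← h]
    exact hy
  have h2 : IsLocalization p.primeCompl (Localization.AtPrime Q ⧸
      (Ideal.span {f}).map (algebraMap R (Localization.AtPrime Q))) := by
    rw [← h1]; infer_instance
  have h3 : (Ideal.span {f}).map (algebraMap R (Localization.AtPrime Q)) =
      Ideal.span {algebraMap R (Localization.AtPrime Q) f} := by
    rw [Ideal.map_span, Set.image_singleton]
  exact ⟨(IsLocalization.algEquiv p.primeCompl (Localization.AtPrime p) _).toRingEquiv.trans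
    (Ideal.quotEquivOfEq h3)⟩

lemma algebraMap_mem_maximalIdeal_of_comap (p : Ideal (R ⧸ Ideal.span {f})) [p.IsPrime] :
    algebraMap R (Localization.AtPrime (p.comap (Ideal.Quotient.mk (Ideal.span {f})))) f ∈
      maximalIdeal _ :=
  (IsLocalization.AtPrime.to_map_mem_maximal_iff _ _ _).mpr (mem_comap_quotient_span_singleton p)

/-- Heights are dimensions of local rings, and dividing by a nonzerodivisor of the maximal ideal
lowers the dimension by exactly one. -/
theorem height_comap_quotient_span_singleton [IsNoetherianRing R] (hf : f ∈ nonZeroDivisors R)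
    (p : Ideal (R ⧸ Ideal.span {f})) [p.IsPrime] :
    (p.comap (Ideal.Quotient.mk (Ideal.span {f}))).height = p.height + 1 := by
  obtain ⟨e⟩ := nonempty_localization_quotient_ringEquiv p
  have h1 := ringKrullDim_quotient_span_singleton_succ_eq_ringKrullDim_of_mem_nonZeroDivisors
    (IsLocalization.map_nonZeroDivisors_le
      (p.comap (Ideal.Quotient.mk (Ideal.span {f}))).primeCompl
      (Localization.AtPrime (p.comap (Ideal.Quotient.mk (Ideal.span {f}))))
      (Submonoid.mem_map_of_mem _ hf)) (algebraMap_mem_maximalIdeal_of_comap p)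
  rw [← ringKrullDim_eq_of_ringEquiv e, IsLocalization.AtPrime.ringKrullDim_eq_height p,
    IsLocalization.AtPrime.ringKrullDim_eq_height
      (p.comap (Ideal.Quotient.mk (Ideal.span {f})))] at h1
  exact_mod_cast h1.symm

/-- Hypersurfaces in regular rings are Cohen–Macaulay: ideals of height at least `n` contain a
regular sequence of length `n`. -/
theorem exists_isWeaklyRegular_quotient [IsRegularRing R] (hf : f ∈ nonZeroDivisors R)
    (J : Ideal (R ⧸ Ideal.span {f})) (n : ℕ)
    (hJ : ∀ p : Ideal (R ⧸ Ideal.span {f}), p.IsPrime → J ≤ p → (n : ℕ∞) ≤ p.height) :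
    ∃ rs : List (R ⧸ Ideal.span {f}), (∀ r ∈ rs, r ∈ J) ∧ rs.length = n ∧
      IsWeaklyRegular (R ⧸ Ideal.span {f}) rs := by
  have hf' : IsWeaklyRegular R [f] :=
    (isWeaklyRegular_singleton_iff R f).mpr (Module.Flat.isSMulRegular_of_nonZeroDivisors hf)
  -- The sequence is found in R as an extension of [f]; the height gained in passing from R/(f) to R
  -- pays for the term f.
  obtain ⟨ts, h1, h2, h3⟩ := exists_isWeaklyRegular_append
    (J.comap (Ideal.Quotient.mk (Ideal.span {f}))) [f] hf' n fun Q hQ hle ↦ by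
      have hfQ : Ideal.span {f} ≤ Q := le_trans
        ((Ideal.span_singleton_le_iff_mem _).mpr (mem_comap_quotient_span_singleton J)) hle
      have hc : (Q.map (Ideal.Quotient.mk (Ideal.span {f}))).comap
          (Ideal.Quotient.mk (Ideal.span {f})) = Q := by
        rw [Ideal.comap_map_of_surjective' _ Ideal.Quotient.mk_surjective, Ideal.mk_ker,
          sup_eq_left.mpr hfQ]
      have hp : (Q.map (Ideal.Quotient.mk (Ideal.span {f}))).IsPrime :=
        Ideal.map_isPrime_of_surjective Ideal.Quotient.mk_surjective (by rwa [Ideal.mk_ker])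
      have h4 := hJ _ hp (by
        rw [← Ideal.map_comap_of_surjective _ Ideal.Quotient.mk_surjective J]
        exact Ideal.map_mono hle)
      have h5 := height_comap_quotient_span_singleton hf (Q.map (Ideal.Quotient.mk (Ideal.span {f})))
      rw [hc] at h5
      rw [h5, List.length_singleton, add_comm 1 n]
      push_cast
      gcongr
  refine ⟨ts.map (Ideal.Quotient.mk _), ?_, by simpa using h2, isWeaklyRegular_quotient_map f h3⟩
  simp only [List.mem_map]
  rintro _ ⟨t, ht, rfl⟩
  exact h1 t ht

lemma nonempty_quotient_ofList_equiv (rs : List R) :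
    Nonempty ((R ⧸ (Ideal.ofList (f :: rs) • ⊤ : Submodule R R)) ≃ₗ[R]
      ((R ⧸ Ideal.span {f}) ⧸ (Ideal.ofList (rs.map (Ideal.Quotient.mk (Ideal.span {f}))) • ⊤ :
        Submodule (R ⧸ Ideal.span {f}) (R ⧸ Ideal.span {f})))) := by
  let N : Submodule (R ⧸ Ideal.span {f}) (R ⧸ Ideal.span {f}) :=
    Ideal.ofList (rs.map (Ideal.Quotient.mk (Ideal.span {f}))) • ⊤
  let φ : R →ₗ[R] (R ⧸ Ideal.span {f}) ⧸ N :=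
    (N.mkQ.restrictScalars R) ∘ₗ (Ideal.span {f}).mkQ
  have hφ : Function.Surjective φ :=
    (Submodule.mkQ_surjective N).comp (Submodule.mkQ_surjective (Ideal.span {f}))
  have hk : (Ideal.ofList (f :: rs) • ⊤ : Submodule R R) = LinearMap.ker φ := by
    ext x
    have h1 : x ∈ LinearMap.ker φ ↔ Ideal.Quotient.mk (Ideal.span {f}) x ∈ N :=
      Submodule.Quotient.mk_eq_zero N
    have h2 : N = (Ideal.ofList rs).map (Ideal.Quotient.mk (Ideal.span {f})) := by
      rw [Ideal.map_ofList, ← Ideal.mul_top (Ideal.ofList _)]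
      rfl
    rw [h1, h2, ← Ideal.mem_comap,
      Ideal.comap_map_of_surjective' _ Ideal.Quotient.mk_surjective, Ideal.mk_ker,
      Ideal.ofList_cons, smul_eq_mul, Ideal.mul_top, sup_comm]
  exact ⟨Submodule.quotEquivOfEq _ _ hk ≪≫ₗ φ.quotKerEquivOfSurjective hφ⟩

lemma nonempty_quotient_comap_equiv (m : Ideal (R ⧸ Ideal.span {f})) :
    Nonempty ((R ⧸ m.comap (Ideal.Quotient.mk (Ideal.span {f}))) ≃ₗ[R]
      ((R ⧸ Ideal.span {f}) ⧸ m)) := by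
  let φ : R →ₗ[R] (R ⧸ Ideal.span {f}) ⧸ m :=
    (m.mkQ.restrictScalars R) ∘ₗ (Ideal.span {f}).mkQ
  have hφ : Function.Surjective φ :=
    (Submodule.mkQ_surjective m).comp (Submodule.mkQ_surjective (Ideal.span {f}))
  have hk : m.comap (Ideal.Quotient.mk (Ideal.span {f})) = LinearMap.ker φ := by
    ext x
    exact (Submodule.Quotient.mk_eq_zero m).symm
  exact ⟨Submodule.quotEquivOfEq _ _ hk ≪≫ₗ φ.quotKerEquivOfSurjective hφ⟩

/-- For a regular ring `R` and a maximal ideal `P` of finite height `n`, the module of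
homomorphisms from `R / P` to the quotient by a regular sequence of length `n` in `P` is one
dimensional. -/
theorem nonempty_hom_quotient_ofList_equiv [IsRegularRing R] (P : Ideal R) [P.IsMaximal]
    (rs : List R) (hrs : IsWeaklyRegular R rs) (hP : ∀ r ∈ rs, r ∈ P)
    (hlen : (rs.length : ℕ∞) = P.height) :
    Nonempty (((R ⧸ P) →ₗ[R] R ⧸ (Ideal.ofList rs • ⊤ : Submodule R R)) ≃ₗ[R] (R ⧸ P)) := by
  have hkill : ∀ zs : List R, (∀ r ∈ zs, r ∈ P) → ∀ r ∈ zs, ∀ n : R ⧸ P, r • n = 0 :=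
    fun zs h r hr n ↦ by
      rw [Algebra.smul_def, Ideal.Quotient.algebraMap_eq,
        Ideal.Quotient.eq_zero_iff_mem.mpr (h r hr), zero_mul]
  have hreg : IsWeaklyRegular (Localization.AtPrime P) rs := by
    rw [← isWeaklyRegular_map_algebraMap_iff (S := Localization.AtPrime P)]
    exact hrs.of_isLocalization _ P.primeCompl
  obtain ⟨zs, hz, hzlen, hspan, hzreg⟩ := exists_isWeaklyRegular_localization P
  have hl : rs.length = zs.length := by
    rw [← hzlen] at hlen; exact_mod_cast hlen
  -- Both sequences have length the height of P, so both compute Ext(R/P, R_P) in that degree. For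
  -- `zs`, which generates P R_P, the answer is Hom(R/P, R/P) ≅ R/P.
  obtain ⟨e1⟩ := ModExt.nonempty_equiv_of_isWeaklyRegular (N := R ⧸ P) hreg (hkill rs hP)
  obtain ⟨e2⟩ := ModExt.nonempty_equiv_of_isWeaklyRegular (N := R ⧸ P) hzreg (hkill zs hz)
  rw [← hl] at e2
  have := isLocalizedModule_mapQ_smul_top P.primeCompl
    (Algebra.linearMap R (Localization.AtPrime P)) (Ideal.ofList rs)
  obtain ⟨e0⟩ := nonempty_linearMap_equiv_of_isLocalizedModule P
    (Submodule.mapQ (Ideal.ofList rs • ⊤ : Submodule R R)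
    (Ideal.ofList rs • ⊤ : Submodule R (Localization.AtPrime P))
    (Algebra.linearMap R (Localization.AtPrime P))
    (Submodule.smul_top_le_comap_smul_top _ _))
  have := isLocalizedModule_mapQ_smul_top P.primeCompl
    (Algebra.linearMap R (Localization.AtPrime P)) P
  have h3 : (Ideal.ofList zs • ⊤ : Submodule R (Localization.AtPrime P)) = P • ⊤ := by
    apply le_antisymm
    · exact Submodule.smul_mono_left (Ideal.span_le.mpr hz)
    · rw [Submodule.smul_le]
      intro r hr n _
      have h4 : algebraMap R (Localization.AtPrime P) r ∈
          Ideal.ofList (zs.map (algebraMap R (Localization.AtPrime P))) := by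
        rw [hspan]
        exact (IsLocalization.AtPrime.to_map_mem_maximal_iff _ P _).mpr hr
      rw [Algebra.smul_def, mul_comm]
      rw [← Ideal.map_ofList] at h4
      have h5 : ∀ y ∈ (Ideal.ofList zs).map (algebraMap R (Localization.AtPrime P)),
          ∀ n, n * y ∈ (Ideal.ofList zs • ⊤ : Submodule R (Localization.AtPrime P)) := by
        intro y hy
        rw [Ideal.map] at hy
        induction hy using Submodule.span_induction with
        | mem y hy =>
          obtain ⟨z, hz, rfl⟩ := hy
          intro n
          rw [mul_comm, ← Algebra.smul_def]
          exact Submodule.smul_mem_smul hz trivial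
        | zero => simp
        | add y z _ _ hy hz => intro n; rw [mul_add]; exact add_mem (hy n) (hz n)
        | smul a y _ hy => intro n; rw [smul_eq_mul, ← mul_assoc]; exact hy _
      exact h5 _ h4 n
  have h0 : ∀ a ∈ P, ∀ n : R ⧸ (P • ⊤ : Submodule R R), a • n = 0 := fun a ha n ↦ by
    induction n using Submodule.Quotient.induction_on with | _ n
    rw [← Submodule.Quotient.mk_smul, Submodule.Quotient.mk_eq_zero]
    exact Submodule.smul_mem_smul ha trivial
  have := isLocalizedModule_id_of_isMaximal P h0
  let e3 := IsLocalizedModule.linearEquiv P.primeCompl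
    (LinearMap.id : (R ⧸ (P • ⊤ : Submodule R R)) →ₗ[R] _)
    (Submodule.mapQ (P • ⊤ : Submodule R R)
    (P • ⊤ : Submodule R (Localization.AtPrime P))
    (Algebra.linearMap R (Localization.AtPrime P))
    (Submodule.smul_top_le_comap_smul_top _ _))
  have h6 : (P • ⊤ : Submodule R R) = P := by rw [smul_eq_mul, Ideal.mul_top]
  let e4 : (Localization.AtPrime P ⧸ (Ideal.ofList zs • ⊤ : Submodule R (Localization.AtPrime P)))
      ≃ₗ[R] (R ⧸ P) :=
    Submodule.quotEquivOfEq _ _ h3 ≪≫ₗ e3.symm ≪≫ₗ Submodule.quotEquivOfEq _ _ h6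
  have h7 : ∀ g : (R ⧸ P) →ₗ[R] (R ⧸ P), ∀ r : R ⧸ P, g r = r * g 1 := fun g r ↦ by
    obtain ⟨r, rfl⟩ := Ideal.Quotient.mk_surjective r
    have := g.map_smul r 1
    rwa [Algebra.smul_def, mul_one, Algebra.smul_def] at this
  let e5 : ((R ⧸ P) →ₗ[R] (R ⧸ P)) ≃ₗ[R] (R ⧸ P) :=
    LinearEquiv.ofBijective (LinearMap.applyₗ 1)
      ⟨fun g g' h ↦ by ext; simpa using h, fun x ↦ ⟨LinearMap.mul R (R ⧸ P) x, by simp⟩⟩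
  exact ⟨e0 ≪≫ₗ e1.symm ≪≫ₗ e2 ≪≫ₗ LinearEquiv.congrRight e4 ≪≫ₗ e5⟩

/-- Hypersurfaces in regular rings are Gorenstein. -/
theorem nonempty_modExt_quotient_self_equiv [IsRegularRing R] (hf : f ∈ nonZeroDivisors R)
    (m : Ideal (R ⧸ Ideal.span {f})) [hm : m.IsMaximal] (d : ℕ) (hd : m.height = d) :
    Nonempty (ModExt (R ⧸ Ideal.span {f}) ((R ⧸ Ideal.span {f}) ⧸ m) (R ⧸ Ideal.span {f}) d
      ≃ₗ[R ⧸ Ideal.span {f}] ((R ⧸ Ideal.span {f}) ⧸ m)) := by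
  set A := R ⧸ Ideal.span {f} with hA
  set P := m.comap (Ideal.Quotient.mk (Ideal.span {f})) with hP
  have hPm : P.IsMaximal := Ideal.comap_isMaximal_of_surjective _ Ideal.Quotient.mk_surjective
  have hPh : P.height = d + 1 := by rw [hP, height_comap_quotient_span_singleton hf, hd]
  have hf' : IsWeaklyRegular R [f] :=
    (isWeaklyRegular_singleton_iff R f).mpr (Module.Flat.isSMulRegular_of_nonZeroDivisors hf)
  -- Since f comes first, R/(f, ts) = A/(ts), so Rees's theorem over A reduces the claim to a Hom
  -- computed over R; R → A is onto, so linearity over either ring is the same.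
  obtain ⟨ts, h1, h2, h3⟩ := exists_isWeaklyRegular_append P [f] hf' d fun Q hQ hle ↦ by
    rw [← hPm.eq_of_le hQ.ne_top hle, hPh, List.length_singleton, add_comm 1 d]
    norm_cast
  replace h3 : IsWeaklyRegular R (f :: ts) := h3
  have hmem : ∀ r ∈ f :: ts, r ∈ P := by
    intro r hr
    rcases List.mem_cons.mp hr with rfl | hr
    exacts [mem_comap_quotient_span_singleton m, h1 r hr]
  obtain ⟨e1⟩ := nonempty_hom_quotient_ofList_equiv P (f :: ts) h3 hmem (by
    rw [hPh, List.length_cons, h2]; norm_cast)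
  obtain ⟨e2⟩ := nonempty_quotient_ofList_equiv (f := f) ts
  obtain ⟨e3⟩ := nonempty_quotient_comap_equiv m
  obtain ⟨e4⟩ := ModExt.nonempty_equiv_of_isWeaklyRegular (N := A ⧸ m)
    (isWeaklyRegular_quotient_map f h3) (by
      simp only [List.mem_map]
      rintro _ ⟨t, ht, rfl⟩ n
      induction n using Submodule.Quotient.induction_on with | _ n
      rw [← Submodule.Quotient.mk_smul, Submodule.Quotient.mk_eq_zero]
      exact m.mul_mem_right n (h1 t ht))
  rw [List.length_map, h2] at e4
  have hs : Function.Surjective (algebraMap R A) := Ideal.Quotient.mk_surjective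
  let e5 := (LinearMap.extendScalarsOfSurjectiveEquiv (M := A ⧸ m)
    (N := A ⧸ (Ideal.ofList (ts.map (Ideal.Quotient.mk (Ideal.span {f}))) • ⊤ :
      Submodule A A)) hs)
  let e6 := e5.symm.restrictScalars R ≪≫ₗ e3.symm.congrLeft _ R ≪≫ₗ e2.symm.congrRight ≪≫ₗ e1 ≪≫ₗ e3
  exact ⟨e4 ≪≫ₗ e6.extendScalarsOfSurjective hs⟩

end HypersurfaceQuotient

/-! ### The Jacobian criterion for hypersurfaces. -/

section Jacobian

open IsLocalRing KaehlerDifferential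
open scoped Pointwise TensorProduct

/-- When x lies in the square of the maximal ideal, lifts of generators of the quotient's maximal
ideal generate the maximal ideal modulo its square, hence outright by Nakayama. -/
lemma spanFinrank_maximalIdeal_le_quotient {B : Type*} [CommRing B] [IsLocalRing B]
    [IsNoetherianRing B] {x : B} (hx : x ∈ maximalIdeal B) (hx2 : x ∈ maximalIdeal B ^ 2)
    [IsLocalRing (B ⧸ Ideal.span {x})] :
    (maximalIdeal B).spanFinrank ≤ (maximalIdeal (B ⧸ Ideal.span {x})).spanFinrank := by
  obtain ⟨s, hcard, hspan⟩ := Submodule.FG.exists_span_set_encard_eq_spanFinrank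
    (IsNoetherian.noetherian (maximalIdeal (B ⧸ Ideal.span {x})))
  have hs : s.Finite := Set.finite_of_encard_eq_coe hcard
  replace hcard : s.ncard = (maximalIdeal (B ⧸ Ideal.span {x})).spanFinrank := by
    rw [Set.ncard, hcard, ENat.toNat_natCast]
  choose l hl using Ideal.Quotient.mk_surjective (I := Ideal.span {x})
  have hsm : ∀ y ∈ s, l y ∈ maximalIdeal B := fun y hy ↦ by
    have h1 : y ∈ maximalIdeal (B ⧸ Ideal.span {x}) := hspan ▸ Submodule.subset_span hy
    rw [maximalIdeal_quotient_span_singleton hx, ← hl y, Ideal.mem_quotient_iff_mem] at h1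
    · exact h1
    · exact (Ideal.span_singleton_le_iff_mem _).mpr hx
  have h2 : maximalIdeal B ≤ Submodule.span B (l '' s) := by
    refine Submodule.le_of_le_smul_of_le_jacobson_bot (IsNoetherian.noetherian _)
      (IsLocalRing.maximalIdeal_le_jacobson ⊥) fun y hy ↦ ?_
    have h3 : Ideal.Quotient.mk (Ideal.span {x}) y ∈
        (Ideal.span (l '' s)).map (Ideal.Quotient.mk (Ideal.span {x})) := by
      rw [Ideal.map_span, ← Set.image_comp]
      have : ((Ideal.Quotient.mk (Ideal.span {x})) ∘ l) '' s = s := by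
        rw [show ((Ideal.Quotient.mk (Ideal.span {x})) ∘ l) = id from funext hl, Set.image_id]
      rw [this]
      change _ ∈ Submodule.span _ s
      rw [hspan, maximalIdeal_quotient_span_singleton hx]
      exact Ideal.mem_map_of_mem _ hy
    rw [← Ideal.mem_comap, Ideal.comap_map_of_surjective' _ Ideal.Quotient.mk_surjective,
      Ideal.mk_ker] at h3
    refine (sup_le_sup_left (c := Ideal.span (l '' s)) (?_ : Ideal.span {x} ≤ _)) h3
    rw [smul_eq_mul, ← pow_two]
    exact (Ideal.span_singleton_le_iff_mem _).mpr hx2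
  have h3 : maximalIdeal B = Submodule.span B (l '' s) :=
    le_antisymm h2 (Submodule.span_le.mpr (by rintro _ ⟨y, hy, rfl⟩; exact hsm y hy))
  rw [h3, ← hcard]
  exact (Submodule.spanFinrank_span_le_ncard_of_finite (hs.image _)).trans (Set.ncard_image_le hs)

/-- A hypersurface singular to order two is not regular. -/
theorem not_isRegularLocalRing_quotient_of_mem_sq {B : Type*} [CommRing B] [IsRegularLocalRing B]
    {x : B} (hx : x ∈ nonZeroDivisors B) (hx2 : x ∈ maximalIdeal B ^ 2) :
    ¬ IsRegularLocalRing (B ⧸ Ideal.span {x}) := by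
  intro h
  have hxm : x ∈ maximalIdeal B := Ideal.pow_le_self two_ne_zero hx2
  have h1 := ringKrullDim_quotient_span_singleton_succ_eq_ringKrullDim_of_mem_nonZeroDivisors hx hxm
  have h2 := spanFinrank_maximalIdeal_le_quotient hxm hx2
  rw [← IsRegularLocalRing.spanFinrank_maximalIdeal (R := B),
    ← IsRegularLocalRing.spanFinrank_maximalIdeal (R := B ⧸ Ideal.span {x})] at h1
  norm_cast at h1
  lia

variable (k : Type v) [Field k] {R : Type u} [CommRing R] [Algebra k R] {f : R}

/-- The differential of the equation `f`, restricted to `V(f)`. -/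
noncomputable def conormalDifferential (f : R) :
    (R ⧸ Ideal.span {f}) ⊗[R] Ω[R⁄k] := 1 ⊗ₜ D k R f

/-- The Jacobian ideal of the hypersurface `V(f)`. -/
noncomputable def jacobianIdeal (f : R) : Ideal (R ⧸ Ideal.span {f}) :=
  LinearMap.range (LinearMap.applyₗ (conormalDifferential k f) :
    Module.Dual (R ⧸ Ideal.span {f}) ((R ⧸ Ideal.span {f}) ⊗[R] Ω[R⁄k]) →ₗ[R ⧸ Ideal.span {f}] _)

lemma mem_jacobianIdeal {a : R ⧸ Ideal.span {f}} : a ∈ jacobianIdeal k f ↔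
    ∃ φ : Module.Dual (R ⧸ Ideal.span {f}) ((R ⧸ Ideal.span {f}) ⊗[R] Ω[R⁄k]),
      φ (conormalDifferential k f) = a := Iff.rfl

/-- Over a perfect field, a function whose differential vanishes at a point of a smooth variety
vanishes to order two there. -/
theorem algebraMap_mem_sq_of_forall_dual [PerfectField k] [Algebra.Smooth k R] (Q : Ideal R)
    [Q.IsPrime] (hfQ : f ∈ Q) (h : ∀ ψ : Module.Dual R Ω[R⁄k], ψ (D k R f) ∈ Q) :
    algebraMap R (Localization.AtPrime Q) f ∈ maximalIdeal (Localization.AtPrime Q) ^ 2 := by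
  let B := Localization.AtPrime Q
  have : Algebra.FormallySmooth R B := .of_isLocalization Q.primeCompl
  have : Algebra.FormallySmooth k B := .comp k R B
  have : Algebra.EssFiniteType R B := .of_isLocalization _ Q.primeCompl
  have : Algebra.EssFiniteType k B := .comp k R B
  have : Algebra.EssFiniteType k (ResidueField B) := .comp k B _
  have hs : Function.Surjective (algebraMap B (ResidueField B)) := residue_surjective
  -- Perfectness of k enters here: the residue field is formally smooth over k, so the cotangent
  -- space of B embeds into κ ⊗ Ω_{B/k}.
  have : Algebra.FormallySmooth k (ResidueField B) := inferInstance
  obtain ⟨l, hl⟩ := (Algebra.FormallySmooth.iff_split_injection (R := k) hs).mp this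
  have hinj : Function.Injective (kerCotangentToTensor k B (ResidueField B)) :=
    Function.LeftInverse.injective (g := l) fun x ↦ LinearMap.congr_fun hl x
  have hker : RingHom.ker (algebraMap B (ResidueField B)) = maximalIdeal B := ker_residue
  have hfm : algebraMap R B f ∈ RingHom.ker (algebraMap B (ResidueField B)) := by
    rw [hker]
    exact (IsLocalization.AtPrime.to_map_mem_maximal_iff _ Q _).mpr hfQ
  rw [← hker]
  refine (Ideal.toCotangent_eq_zero _ ⟨_, hfm⟩).mp (hinj ?_)
  rw [map_zero, kerCotangentToTensor_toCotangent]
  -- A dual basis of the projective module Ω_{R/k}: the coordinates of df are values of linear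
  -- forms, so they lie in Q and vanish in the residue field.
  obtain ⟨n, b, c, -, -, hbc⟩ := Module.Finite.exists_comp_eq_id_of_projective R Ω[R⁄k]
  have h1 : D k B (algebraMap R B f) = ∑ i, c (D k R f) i •
      KaehlerDifferential.map k k R B (b fun j ↦ if i = j then 1 else 0) := by
    rw [← KaehlerDifferential.map_D k k R B f]
    conv_lhs => rw [← LinearMap.id_apply (R := R) (D k R f), ← hbc, LinearMap.comp_apply,
      LinearMap.pi_apply_eq_sum_univ b, map_sum]
    simp only [map_smul]
  have h2 : ∀ i, residue B (algebraMap R B (c (D k R f) i)) = 0 := fun i ↦ by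
    rw [residue_eq_zero_iff]
    exact (IsLocalization.AtPrime.to_map_mem_maximal_iff _ Q _).mpr
      (h (LinearMap.proj i ∘ₗ c))
  rw [h1, TensorProduct.tmul_sum]
  refine Finset.sum_eq_zero fun i _ ↦ ?_
  rw [← algebraMap_smul B (c (D k R f) i), TensorProduct.tmul_smul, TensorProduct.smul_tmul',
    Algebra.smul_def, ResidueField.algebraMap_eq, h2, zero_mul, TensorProduct.zero_tmul]

/-- The Jacobian ideal does not vanish at regular points. -/
theorem not_jacobianIdeal_le_of_isRegularLocalRing [PerfectField k] [Algebra.Smooth k R]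
    (hf : f ∈ nonZeroDivisors R) (p : Ideal (R ⧸ Ideal.span {f})) [p.IsPrime]
    (hp : IsRegularLocalRing (Localization.AtPrime p)) : ¬ jacobianIdeal k f ≤ p := by
  intro hle
  have := IsRegularRing.of_smooth k R
  obtain ⟨e⟩ := nonempty_localization_quotient_ringEquiv p
  have h1 := IsRegularLocalRing.of_ringEquiv e
  refine not_isRegularLocalRing_quotient_of_mem_sq ?_ ?_ h1
  · exact (IsLocalization.map_nonZeroDivisors_le
      (p.comap (Ideal.Quotient.mk (Ideal.span {f}))).primeCompl _
      (Submonoid.mem_map_of_mem _ hf))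
  · refine algebraMap_mem_sq_of_forall_dual k _ (mem_comap_quotient_span_singleton p) fun ψ ↦ ?_
    refine hle ((mem_jacobianIdeal k).mpr ⟨Module.Dual.baseChange _ ψ, ?_⟩)
    rw [conormalDifferential, Module.Dual.baseChange_apply_tmul, Algebra.smul_def, mul_one]
    rfl

/-- The Jacobian ideal vanishes at singular points. -/
theorem jacobianIdeal_le_of_not_isRegularLocalRing [Algebra.Smooth k R]
    (p : Ideal (R ⧸ Ideal.span {f})) [p.IsPrime]
    (hp : ¬ IsRegularLocalRing (Localization.AtPrime p)) : jacobianIdeal k f ≤ p := by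
  have := IsRegularRing.of_smooth k R
  set Q := p.comap (Ideal.Quotient.mk (Ideal.span {f})) with hQ
  have h1 : algebraMap R (Localization.AtPrime Q) f ∈ maximalIdeal (Localization.AtPrime Q) ^ 2 := by
    by_contra h
    obtain ⟨e⟩ := nonempty_localization_quotient_ringEquiv p
    have := IsRegularLocalRing.quotient_span_singleton (algebraMap_mem_maximalIdeal_of_comap p) h
    exact hp (.of_ringEquiv e.symm)
  rw [← Localization.AtPrime.map_eq_maximalIdeal, ← Ideal.map_pow,
    IsLocalization.algebraMap_mem_map_algebraMap_iff Q.primeCompl] at h1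
  -- Here s f ∈ Q² with s ∉ Q. By Leibniz, forms send the differential of an element of Q² into p,
  -- and d(s f) restricts to s df on V(f).
  obtain ⟨s, hs, hsf⟩ := h1
  intro a ha
  obtain ⟨φ, rfl⟩ := (mem_jacobianIdeal k).mp ha
  have h2 : ∀ x ∈ Q ^ 2, φ (1 ⊗ₜ D k R x) ∈ p := by
    intro x hx
    rw [pow_two] at hx
    induction hx using Submodule.mul_induction_on' with
    | mem_mul_mem y hy z hz =>
      rw [Derivation.leibniz, TensorProduct.tmul_add, TensorProduct.tmul_smul,
        TensorProduct.tmul_smul, map_add, φ.map_smul_of_tower, φ.map_smul_of_tower]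
      exact add_mem (p.mul_mem_right _ hy) (p.mul_mem_right _ hz)
    | add y _ z _ hy hz =>
      rw [map_add, TensorProduct.tmul_add, map_add]
      exact add_mem hy hz
  have h3 := h2 _ hsf
  have h4 : ∀ ω : Ω[R⁄k], f • ((1 : R ⧸ Ideal.span {f}) ⊗ₜ[R] ω) = 0 := fun ω ↦ by
    rw [TensorProduct.smul_tmul', Algebra.smul_def, Ideal.Quotient.algebraMap_eq,
      Ideal.Quotient.eq_zero_iff_mem.mpr (Ideal.mem_span_singleton_self f), zero_mul,
      TensorProduct.zero_tmul]
  rw [Derivation.leibniz, TensorProduct.tmul_add, TensorProduct.tmul_smul,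
        TensorProduct.tmul_smul, h4, add_zero, φ.map_smul_of_tower] at h3
  exact (‹p.IsPrime›.mem_or_mem h3).resolve_left hs

end Jacobian

/-! ### Exterior multiplication, contraction and de Rham–Saito division. -/

section ExteriorPower

open RingTheory.Sequence
open scoped Pointwise

namespace exteriorPower

variable {A M M' : Type*} [CommRing A] [AddCommGroup M] [Module A M] [AddCommGroup M'] [Module A M']

/-- Exterior multiplication `x ↦ w ∧ x`. -/
noncomputable def wedge (w : M) (n : ℕ) : (⋀[A]^n M) →ₗ[A] (⋀[A]^(n + 1) M) :=
  (LinearMap.mulLeft A (ExteriorAlgebra.ι A w)).restrict fun x hx ↦ by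
    rw [LinearMap.mulLeft_apply, ExteriorAlgebra.exteriorPower, pow_succ']
    exact Submodule.mul_mem_mul (LinearMap.mem_range_self _ w) hx

@[simp] lemma coe_wedge (w : M) (n : ℕ) (x : ⋀[A]^n M) :
    (wedge w n x : ExteriorAlgebra A M) = ExteriorAlgebra.ι A w * x := rfl

lemma wedge_wedge (w : M) (n : ℕ) (x : ⋀[A]^n M) : wedge w (n + 1) (wedge w n x) = 0 := by
  ext
  rw [coe_wedge, coe_wedge, ← mul_assoc, ExteriorAlgebra.ι_sq_zero, zero_mul]
  rfl

lemma contractLeft_mem (φ : Module.Dual A M) (n : ℕ) :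
    ∀ x ∈ ⋀[A]^(n + 1) M, CliffordAlgebra.contractLeft φ x ∈ ⋀[A]^n M := by
  induction n with
  | zero =>
    intro x hx
    rw [zero_add, ExteriorAlgebra.exteriorPower, pow_one] at hx
    obtain ⟨v, rfl⟩ := hx
    rw [ExteriorAlgebra.exteriorPower, pow_zero, Submodule.mem_one]
    exact ⟨φ v, (CliffordAlgebra.contractLeft_ι (d := φ) _ v).symm⟩
  | succ n ih =>
    intro x hx
    rw [ExteriorAlgebra.exteriorPower, pow_succ'] at hx
    induction hx using Submodule.mul_induction_on' with
    | mem_mul_mem y hy z hz =>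
      obtain ⟨v, rfl⟩ := hy
      rw [ExteriorAlgebra.ι, CliffordAlgebra.contractLeft_ι_mul]
      refine sub_mem (Submodule.smul_mem _ _ hz) ?_
      rw [ExteriorAlgebra.exteriorPower, pow_succ']
      exact Submodule.mul_mem_mul (LinearMap.mem_range_self _ v) (ih z hz)
    | add y _ z _ hy hz => rw [map_add]; exact add_mem hy hz

/-- Contraction of an exterior power with a linear form. -/
noncomputable def contract (φ : Module.Dual A M) (n : ℕ) : (⋀[A]^(n + 1) M) →ₗ[A] (⋀[A]^n M) :=
  (CliffordAlgebra.contractLeft φ).restrict (contractLeft_mem φ n)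

@[simp] lemma coe_contract (φ : Module.Dual A M) (n : ℕ) (x : ⋀[A]^(n + 1) M) :
    (contract φ n x : ExteriorAlgebra A M) = CliffordAlgebra.contractLeft φ x.1 := rfl

/-- Contraction is an antiderivation. Degree 0 is stated separately, since there the correction term
is absent. -/
lemma contract_wedge_succ (φ : Module.Dual A M) (w : M) (n : ℕ) (x : ⋀[A]^(n + 1) M) :
    contract φ (n + 1) (wedge w (n + 1) x) = φ w • x - wedge w n (contract φ n x) :=
  Subtype.ext (CliffordAlgebra.contractLeft_ι_mul (d := φ) w x.1)

lemma contract_wedge_zero (φ : Module.Dual A M) (w : M) (x : ⋀[A]^0 M) :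
    contract φ 0 (wedge w 0 x) = φ w • x := by
  obtain ⟨a, ha⟩ : ∃ a, algebraMap A (ExteriorAlgebra A M) a = x := by
    have : (x : ExteriorAlgebra A M) ∈ LinearMap.range (ExteriorAlgebra.ι A) ^ 0 := x.2
    rwa [pow_zero, Submodule.mem_one] at this
  ext
  rw [coe_contract, coe_wedge, ExteriorAlgebra.ι, CliffordAlgebra.contractLeft_ι_mul, ← ha]
  erw [CliffordAlgebra.contractLeft_algebraMap]
  simp [ha]

/-- The multiples of `w` in the exterior powers. -/
noncomputable def wedgeRange (w : M) : ∀ n, Submodule A (⋀[A]^n M)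
  | 0 => ⊥
  | n + 1 => LinearMap.range (wedge w n)

lemma wedge_eq_zero_of_mem_wedgeRange (w : M) : ∀ n, ∀ x ∈ (wedgeRange w n : Submodule A _),
    wedge w n x = 0
  | 0, x, hx => by rw [(Submodule.mem_bot A).mp hx, map_zero]
  | n + 1, _, ⟨y, rfl⟩ => wedge_wedge w n y

lemma mem_smul_top_of_smul_mem {N : Type*} [AddCommGroup N] [Module A N] {rs : List A}
    (hreg : IsWeaklyRegular N rs) {r : ℕ} (hr : r < rs.length) {x : N}
    (hx : rs[r] • x ∈ (Ideal.ofList (rs.take r) • ⊤ : Submodule A N)) :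
    x ∈ (Ideal.ofList (rs.take r) • ⊤ : Submodule A N) := by
  rw [← Submodule.Quotient.mk_eq_zero] at hx ⊢
  exact hreg.regular_mod_prev r hr (by simpa using hx)

/-- De Rham–Saito division modulo an initial segment of a regular sequence. -/
theorem mem_wedgeRange_sup_of_wedge_mem (w : M) (rs : List A)
    (hrs : ∀ r ∈ rs, ∃ φ : Module.Dual A M, φ w = r)
    (hreg : ∀ n, IsWeaklyRegular (⋀[A]^n M) rs) (n r : ℕ) (hnr : n + r < rs.length)
    (x : ⋀[A]^n M)
    (hx : wedge w n x ∈ (Ideal.ofList (rs.take r) • ⊤ : Submodule A (⋀[A]^(n + 1) M))) :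
    x ∈ wedgeRange w n ⊔ (Ideal.ofList (rs.take r) • ⊤ : Submodule A (⋀[A]^n M)) := by
  have hr : r < rs.length := by lia
  induction n generalizing r with
  | zero =>
    obtain ⟨φ, hφ⟩ := hrs rs[r] (List.getElem_mem hr)
    have hc := Submodule.smul_top_le_comap_smul_top _ (contract φ 0) hx
    rw [Submodule.mem_comap] at hc
    rw [contract_wedge_zero, hφ] at hc
    exact Submodule.mem_sup_right (mem_smul_top_of_smul_mem (hreg 0) hr hc)
  | succ n ih =>
    obtain ⟨φ, hφ⟩ := hrs rs[r] (List.getElem_mem hr)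
    have hc := Submodule.smul_top_le_comap_smul_top _ (contract φ (n + 1)) hx
    rw [Submodule.mem_comap] at hc
    rw [contract_wedge_succ, hφ] at hc
    have hI : Ideal.ofList (rs.take (r + 1)) = Ideal.ofList (rs.take r) ⊔ Ideal.span {rs[r]} := by
      rw [← List.take_concat_get' rs r hr, Ideal.ofList_append, Ideal.ofList_singleton]
    -- With φ w = rs[r], contraction gives rs[r] x ≡ w ∧ (φ ⌟ x) modulo the first r terms. So φ ⌟ x
    -- satisfies the hypothesis in one degree less and modulo one more term; n + r is unchanged.
    have h1 : wedge w n (contract φ n x) ∈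
        (Ideal.ofList (rs.take (r + 1)) • ⊤ : Submodule A (⋀[A]^(n + 1) M)) := by
      rw [← sub_sub_cancel (rs[r] • x) (wedge w n (contract φ n x)), hI, Submodule.sup_smul]
      exact sub_mem (Submodule.mem_sup_right (Submodule.smul_mem_smul
        (Ideal.mem_span_singleton_self _) trivial)) (Submodule.mem_sup_left hc)
    have h2 := ih (r + 1) (by lia) (contract φ n x) h1 (by lia)
    obtain ⟨u, hu, v, hv, huv⟩ := Submodule.mem_sup.mp h2
    rw [hI, Submodule.sup_smul, Submodule.ideal_span_singleton_smul] at hv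
    obtain ⟨v', hv', _, ⟨z, -, rfl⟩, hz⟩ := Submodule.mem_sup.mp hv
    -- Write φ ⌟ x = u + v' + rs[r] z with u a multiple of w and v' in the first r terms.
    -- Multiplying by w kills u, and regularity of rs[r] then cancels it.
    have h3 : rs[r] • (x - wedge w n z) ∈
        (Ideal.ofList (rs.take r) • ⊤ : Submodule A (⋀[A]^(n + 1) M)) := by
      have h4 : rs[r] • (x - wedge w n z) =
          (rs[r] • x - wedge w n (contract φ n x)) + wedge w n v' := by
        rw [← huv, ← hz, map_add, map_add, wedge_eq_zero_of_mem_wedgeRange w n u hu, smul_sub]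
        change _ = _ - (0 + (wedge w n v' + wedge w n (rs[r] • z))) + _
        rw [map_smul]
        abel
      rw [h4]
      exact add_mem hc (Submodule.smul_top_le_comap_smul_top _ (wedge w n) hv')
    have h5 := mem_smul_top_of_smul_mem (hreg (n + 1)) hr h3
    exact Submodule.mem_sup.mpr ⟨_, ⟨z, rfl⟩, _, h5, add_sub_cancel _ _⟩

/-- De Rham–Saito division: if `rs` is a regular sequence of coordinates `φ w` of `w`, then forms of
degree less than the length of `rs` annihilated by `w` are multiples of `w`. -/
theorem ker_wedge_eq_wedgeRange (w : M) (rs : List A)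
    (hrs : ∀ r ∈ rs, ∃ φ : Module.Dual A M, φ w = r)
    (hreg : ∀ n, IsWeaklyRegular (⋀[A]^n M) rs) (n : ℕ) (hn : n < rs.length) :
    LinearMap.ker (wedge w n : _ →ₗ[A] _) = wedgeRange w n := by
  refine le_antisymm (fun x hx ↦ ?_) (wedge_eq_zero_of_mem_wedgeRange w n)
  have := mem_wedgeRange_sup_of_wedge_mem w rs hrs hreg n 0 hn x (by
    rw [LinearMap.mem_ker.mp hx]; exact zero_mem _)
  simpa using this

/-- Multiplication by `w` commutes with the algebra up to automorphism. -/
lemma exists_ι_mul_eq (w : M) (x : ExteriorAlgebra A M) :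
    ∃ y, ExteriorAlgebra.ι A w * x = y * ExteriorAlgebra.ι A w := by
  induction x using ExteriorAlgebra.induction with
  | algebraMap r => exact ⟨algebraMap A _ r, (Algebra.commutes r _).symm⟩
  | ι v => exact ⟨-ExteriorAlgebra.ι A v, by
      rw [neg_mul, eq_neg_iff_add_eq_zero, ExteriorAlgebra.ι_add_mul_swap]⟩
  | mul a b ha hb =>
    obtain ⟨a', ha⟩ := ha
    obtain ⟨b', hb⟩ := hb
    exact ⟨a' * b', by rw [← mul_assoc, ha, mul_assoc, hb, mul_assoc]⟩
  | add a b ha hb =>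
    obtain ⟨a', ha⟩ := ha
    obtain ⟨b', hb⟩ := hb
    exact ⟨a' + b', by rw [mul_add, ha, hb, add_mul]⟩

lemma exists_mul_ι_eq (w : M) (x : ExteriorAlgebra A M) :
    ∃ y, x * ExteriorAlgebra.ι A w = ExteriorAlgebra.ι A w * y := by
  induction x using ExteriorAlgebra.induction with
  | algebraMap r => exact ⟨algebraMap A _ r, Algebra.commutes r _⟩
  | ι v => exact ⟨-ExteriorAlgebra.ι A v, by
      rw [mul_neg, eq_neg_iff_add_eq_zero, ExteriorAlgebra.ι_add_mul_swap]⟩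
  | mul a b ha hb =>
    obtain ⟨a', ha⟩ := ha
    obtain ⟨b', hb⟩ := hb
    exact ⟨a' * b', by rw [mul_assoc, hb, ← mul_assoc, ha, mul_assoc]⟩
  | add a b ha hb =>
    obtain ⟨a', ha⟩ := ha
    obtain ⟨b', hb⟩ := hb
    exact ⟨a' + b', by rw [add_mul, ha, hb, mul_add]⟩

/-- The kernel of `⋀ M → ⋀ (M / A w)` consists of the multiples of `w`. -/
theorem exists_eq_ι_mul_of_map_eq_zero (q : M →ₗ[A] M') (hq : Function.Surjective q) (w : M)
    (hw : LinearMap.ker q = A ∙ w) (x : ExteriorAlgebra A M)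
    (hx : ExteriorAlgebra.map q x = 0) : ∃ y, x = ExteriorAlgebra.ι A w * y := by
  -- The left ideal of w is two-sided, so the quotient is an algebra. The universal property of ⋀ M'
  -- maps into it, and the composite from ⋀ M is the quotient map; its kernel therefore contains
  -- that of ⋀ q.
  let I : Ideal (ExteriorAlgebra A M) := Ideal.span {ExteriorAlgebra.ι A w}
  have hI : I.IsTwoSided := ⟨fun {a} b ha ↦ by
    obtain ⟨c, rfl⟩ := Ideal.mem_span_singleton'.mp ha
    obtain ⟨y, hy⟩ := exists_ι_mul_eq w b
    exact Ideal.mem_span_singleton'.mpr ⟨c * y, by rw [mul_assoc, mul_assoc, hy]⟩⟩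
  let π : ExteriorAlgebra A M →ₐ[A] ExteriorAlgebra A M ⧸ I := Ideal.Quotient.mkₐ A I
  let g : (M ⧸ LinearMap.ker q) →ₗ[A] ExteriorAlgebra A M ⧸ I :=
    Submodule.liftQ _ (π.toLinearMap ∘ₗ ExteriorAlgebra.ι A) (by
      rw [hw, Submodule.span_singleton_le_iff_mem, LinearMap.mem_ker]
      exact Ideal.Quotient.eq_zero_iff_mem.mpr (Ideal.mem_span_singleton_self _))
  let h : M' →ₗ[A] ExteriorAlgebra A M ⧸ I :=
    g ∘ₗ (q.quotKerEquivOfSurjective hq).symm.toLinearMap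
  have hh : ∀ m, h (q m) = π (ExteriorAlgebra.ι A m) := fun m ↦ by
    have : (q.quotKerEquivOfSurjective hq).symm (q m) = Submodule.Quotient.mk m := by
      rw [LinearEquiv.symm_apply_eq]; rfl
    change g ((q.quotKerEquivOfSurjective hq).symm (q m)) = _
    rw [this]
    rfl
  let ψ : ExteriorAlgebra A M' →ₐ[A] ExteriorAlgebra A M ⧸ I := ExteriorAlgebra.lift A ⟨h, fun m ↦ by
    obtain ⟨m, rfl⟩ := hq m
    rw [hh, ← map_mul, ExteriorAlgebra.ι_sq_zero, map_zero]⟩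
  have hψ : ψ.comp (ExteriorAlgebra.map q) = π := by
    ext m
    simp [ψ, hh]
  have h1 : π x = 0 := by
    rw [← hψ, AlgHom.comp_apply, hx, map_zero]
  obtain ⟨y, hy⟩ := Ideal.mem_span_singleton'.mp (Ideal.Quotient.eq_zero_iff_mem.mp h1)
  rw [← hy]
  exact exists_mul_ι_eq w y

lemma coe_map (q : M →ₗ[A] M') (n : ℕ) (x : ⋀[A]^n M) :
    (exteriorPower.map n q x : ExteriorAlgebra A M') = ExteriorAlgebra.map q x := by
  have h : (⋀[A]^n M').subtype ∘ₗ exteriorPower.map n q =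
      (ExteriorAlgebra.map q).toLinearMap ∘ₗ (⋀[A]^n M).subtype := by
    ext m
    simp [ExteriorAlgebra.map_apply_ιMulti]
  exact LinearMap.congr_fun h x

/-- The cofactor of w found in the full algebra need not be homogeneous; taking the degree n part of
the product replaces it by its degree n - 1 part, which is absent for n = 0. -/
theorem ker_map_eq_wedgeRange (q : M →ₗ[A] M') (hq : Function.Surjective q) (w : M)
    (hw : LinearMap.ker q = A ∙ w) (n : ℕ) :
    LinearMap.ker (exteriorPower.map n q) = wedgeRange w n := by
  have hw0 : q w = 0 := LinearMap.mem_ker.mp (hw ▸ Submodule.mem_span_singleton_self w)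
  ext x
  rw [LinearMap.mem_ker, ← Submodule.coe_eq_zero, coe_map]
  constructor
  · intro hx
    obtain ⟨y, hy⟩ := exists_eq_ι_mul_of_map_eq_zero q hq w hw x hx
    have h1 : ExteriorAlgebra.ι A w ∈ ⋀[A]^1 M := by
      rw [ExteriorAlgebra.exteriorPower, pow_one]; exact LinearMap.mem_range_self _ w
    have h2 : (DirectSum.decompose (fun i : ℕ ↦ ⋀[A]^i M) (x : ExteriorAlgebra A M) n :
        ExteriorAlgebra A M) = x := DirectSum.decompose_of_mem_same _ x.2
    cases n with
    | zero =>
      rw [hy, DirectSum.coe_decompose_mul_of_left_mem_of_not_le (fun i : ℕ ↦ ⋀[A]^i M) h1 (by simp), ← hy] at h2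
      exact (Submodule.mem_bot A).mpr (Subtype.ext h2.symm)
    | succ n =>
      rw [hy, DirectSum.coe_decompose_mul_of_left_mem_of_le (fun i : ℕ ↦ ⋀[A]^i M) h1 (by simp), ← hy] at h2
      exact ⟨_, Subtype.ext h2⟩
  · intro hx
    cases n with
    | zero => rw [(Submodule.mem_bot A).mp hx, Submodule.coe_zero, map_zero]
    | succ n =>
      obtain ⟨y, rfl⟩ := hx
      rw [coe_wedge, map_mul, ExteriorAlgebra.map_apply_ι, hw0, map_zero, zero_mul]

instance instProjective [Module.Finite A M] [Module.Projective A M] (n : ℕ) :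
    Module.Projective A (⋀[A]^n M) := by
  obtain ⟨r, f, g, -, -, hfg⟩ := Module.Finite.exists_comp_eq_id_of_projective A M
  refine Module.Projective.of_split (exteriorPower.map n g) (exteriorPower.map n f) ?_
  rw [← exteriorPower.map_comp, hfg, exteriorPower.map_id]

end exteriorPower

end ExteriorPower

/-! ### Exact sequences of exterior powers: reflexivity and degree shifting in Ext. -/

section WedgeExactSequences

open RingTheory.Sequence
open scoped Pointwise

lemma isWeaklyRegular_of_flat {A N : Type*} [CommRing A] [AddCommGroup N] [Module A N]
    [Module.Flat A N] {rs : List A} (h : IsWeaklyRegular A rs) : IsWeaklyRegular N rs :=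
  ((TensorProduct.rid A N).isWeaklyRegular_congr rs).mp h.isWeaklyRegular_lTensor

/-- A module cut out in a reflexive module by a map to a torsionless module is reflexive as soon as
some regular multiple of the identity extends to the ambient module. -/
theorem Module.IsReflexive.of_exact {A N F G : Type*} [CommRing A] [AddCommGroup N] [Module A N]
    [AddCommGroup F] [Module A F] [AddCommGroup G] [Module A G] [Module.IsReflexive A F]
    [Module.IsReflexive A G] {i : N →ₗ[A] F} {p : F →ₗ[A] G} (hi : Function.Injective i)
    (hip : Function.Exact i p) {s : A} (hs : IsSMulRegular A s) (r : F →ₗ[A] N)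
    (hr : r ∘ₗ i = s • LinearMap.id) : Module.IsReflexive A N := by
  -- For every form φ on N the multiple s φ extends to F, so an element of the double dual that dies
  -- in that of F is killed by s on every φ.
  have hdual : Function.Injective i.dualMap.dualMap := by
    rw [injective_iff_map_eq_zero]
    intro ξ hξ
    ext φ
    have h1 : s • φ = i.dualMap (r.dualMap φ) := by
      ext n
      simpa using (congrArg φ (LinearMap.congr_fun hr n)).symm
    have h2 : s • ξ φ = s • (0 : A) := by
      rw [← map_smul, h1, smul_zero]
      exact LinearMap.congr_fun hξ (r.dualMap φ)
    exact hs h2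
  have hnat : ∀ n, i.dualMap.dualMap (Module.Dual.eval A N n) = Module.Dual.eval A F (i n) :=
    fun n ↦ rfl
  refine ⟨⟨fun n n' h ↦ hi ((Module.bijective_dual_eval A F).1 ?_), fun ξ ↦ ?_⟩⟩
  · rw [← hnat, ← hnat, h]
  · obtain ⟨x, hx⟩ := (Module.bijective_dual_eval A F).2 (i.dualMap.dualMap ξ)
    have h1 : p x = 0 := (Module.bijective_dual_eval A G).1 <| by
      rw [map_zero]
      have h2 : Module.Dual.eval A G (p x) = p.dualMap.dualMap (Module.Dual.eval A F x) := rfl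
      rw [h2, hx]
      ext φ
      have h3 : i.dualMap (p.dualMap φ) = 0 := by
        ext n
        simp [hip.apply_apply_eq_zero]
      change ξ (i.dualMap (p.dualMap φ)) = 0
      rw [h3, map_zero]
    obtain ⟨n, rfl⟩ := (hip x).mp h1
    exact ⟨n, hdual (by rw [hnat, hx])⟩

namespace exteriorPower

section

variable {A M M' : Type*} [CommRing A] [AddCommGroup M] [Module A M] [AddCommGroup M'] [Module A M']

lemma wedge_sum_smul {ι : Type*} (s : Finset ι) (a : ι → A) (v : ι → M) (n : ℕ) :
    wedge (∑ k ∈ s, a k • v k) n = ∑ k ∈ s, a k • (wedge (v k) n : _ →ₗ[A] _) := by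
  refine LinearMap.ext fun x ↦ ?_
  apply Subtype.ext
  simp [LinearMap.sum_apply, Finset.sum_mul]

variable {q : M →ₗ[A] M'} (hq : Function.Surjective q) {w : M} (hw : LinearMap.ker q = A ∙ w)

include hq hw in
/-- Exterior multiplication by `w` descends to the exterior powers of `M / A w`. -/
theorem exists_wedge_lift {n : ℕ}
    (hk : LinearMap.ker (wedge w n : _ →ₗ[A] _) = wedgeRange w n) :
    ∃ j : (⋀[A]^n M') →ₗ[A] (⋀[A]^(n + 1) M), j ∘ₗ exteriorPower.map n q = wedge w n ∧
      Function.Injective j ∧ Function.Exact j (exteriorPower.map (n + 1) q) := by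
  have hs := exteriorPower.map_surjective (n := n) hq
  have hker := ker_map_eq_wedgeRange q hq w hw
  let e := (exteriorPower.map n q).quotKerEquivOfSurjective hs
  have he : ∀ x, e.symm (exteriorPower.map n q x) = Submodule.Quotient.mk x := fun x ↦ by
    rw [LinearEquiv.symm_apply_eq]; rfl
  let j := (LinearMap.ker (exteriorPower.map n q)).liftQ (wedge w n) (by rw [hker, hk]) ∘ₗ
    e.symm.toLinearMap
  have hj : ∀ x, j (exteriorPower.map n q x) = wedge w n x := fun x ↦ by
    simp [j, he]
  refine ⟨j, LinearMap.ext hj, ?_, fun x ↦ ?_⟩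
  · rw [injective_iff_map_eq_zero]
    intro x hx
    obtain ⟨x, rfl⟩ := hs x
    rw [hj, ← LinearMap.mem_ker, hk, ← hker] at hx
    exact hx
  · rw [← LinearMap.mem_ker, hker]
    refine ⟨fun ⟨y, hy⟩ ↦ ⟨exteriorPower.map n q y, (hj y).trans hy⟩, fun ⟨y, hy⟩ ↦ ?_⟩
    obtain ⟨y, rfl⟩ := hs y
    exact ⟨y, (hj y).symm.trans hy⟩

variable [Module.Finite A M] [Module.Projective A M] {rs : List A}
  (hrs : ∀ r ∈ rs, ∃ φ : Module.Dual A M, φ w = r) (hreg : IsWeaklyRegular A rs)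

include hrs hreg in
lemma ker_wedge_eq_wedgeRange_of_projective {n : ℕ} (hn : n < rs.length) :
    LinearMap.ker (wedge w n : _ →ₗ[A] _) = wedgeRange w n :=
  ker_wedge_eq_wedgeRange w rs hrs (fun _ ↦ isWeaklyRegular_of_flat hreg) n hn

include hq hw hrs hreg in
/-- The exterior powers of `M / A w` are reflexive in small degrees. -/
theorem isReflexive_of_isWeaklyRegular {n : ℕ} (hn : n + 2 ≤ rs.length) :
    Module.IsReflexive A (⋀[A]^n M') := by
  obtain ⟨j, hj, hinj, hex⟩ := exists_wedge_lift hq hw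
    (ker_wedge_eq_wedgeRange_of_projective hrs hreg (n := n) (by lia))
  have hr : 0 < rs.length := by lia
  obtain ⟨φ, hφ⟩ := hrs rs[0] (List.getElem_mem hr)
  have hs : IsSMulRegular A (φ w) := by
    rw [hφ]
    intro x y hxy
    have h1 : rs[0] • (x - y) ∈ (Ideal.ofList (rs.take 0) • ⊤ : Submodule A A) := by
      rw [smul_sub, sub_eq_zero.mpr hxy]; exact zero_mem _
    have h2 := mem_smul_top_of_smul_mem hreg hr h1
    simpa [sub_eq_zero] using h2
  -- The image of j is ker ⋀^{n+1} q, the multiples of w, which division in degree n + 1 identifies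
  -- with the kernel of w ∧ ·; this is why two terms beyond n are needed.
  have hex' : Function.Exact j (wedge w (n + 1) : _ →ₗ[A] _) := fun x ↦ by
    rw [← LinearMap.mem_ker, ker_wedge_eq_wedgeRange_of_projective hrs hreg (by lia),
      ← ker_map_eq_wedgeRange q hq w hw, LinearMap.mem_ker]
    exact hex x
  -- Contract with φ, then project: x ↦ w ∧ x ↦ φ(w) x - w ∧ (φ ⌟ x), and the last term dies in the
  -- exterior power of M / A w.
  refine Module.IsReflexive.of_exact hinj hex' hs (exteriorPower.map n q ∘ₗ contract φ n) ?_
  refine LinearMap.ext fun x ↦ ?_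
  obtain ⟨x, rfl⟩ := exteriorPower.map_surjective (n := n) hq x
  have h1 : j (exteriorPower.map n q x) = wedge w n x := LinearMap.congr_fun hj x
  change exteriorPower.map n q (contract φ n (j (exteriorPower.map n q x))) =
    φ w • exteriorPower.map n q x
  rw [h1]
  cases n with
  | zero => rw [contract_wedge_zero, map_smul]
  | succ n =>
    have h2 : exteriorPower.map (n + 1) q (wedge w n (contract φ n x)) = 0 := by
      rw [← LinearMap.mem_ker, ker_map_eq_wedgeRange q hq w hw]
      exact ⟨_, rfl⟩
    rw [contract_wedge_succ, map_sub, h2, sub_zero, map_smul]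

end

section

variable {A M M' : Type u} [CommRing A] [AddCommGroup M] [Module A M] [AddCommGroup M']
  [Module A M'] {q : M →ₗ[A] M'} (hq : Function.Surjective q) {w : M}
  (hw : LinearMap.ker q = A ∙ w) [Module.Finite A M] [Module.Projective A M] {rs : List A}
  (hrs : ∀ r ∈ rs, ∃ φ : Module.Dual A M, φ w = r) (hreg : IsWeaklyRegular A rs)
  (N : Type u) [AddCommGroup N] [Module A N] {ds : List A} (hds : IsWeaklyRegular A ds)
  (hN : ∀ r ∈ ds, ∀ n : N, r • n = 0)

include hds hN in
lemma subsingleton_modExt_of_projective (n : ℕ) {l : ℕ} (hl : l < ds.length) :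
    Subsingleton (ModExt A N (⋀[A]^n M) l) :=
  ModExt.subsingleton_of_isWeaklyRegular (isWeaklyRegular_of_flat hds) hN l hl

include hq hw hrs hreg hds hN in
-- Degree shift along 0 → ⋀^n M' → ⋀^{n+1} M → ⋀^{n+1} M' → 0: the projective middle term has no Ext
-- from N below the length of `ds`, and the induction ends at ⋀^0 M' = A.
theorem subsingleton_modExt_of_isWeaklyRegular {n l : ℕ} (hn : n ≤ rs.length)
    (hl : l + n < ds.length) : Subsingleton (ModExt A N (⋀[A]^n M') l) := by
  induction n generalizing l with
  | zero =>
    have := ModExt.subsingleton_of_isWeaklyRegular hds hN l hl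
    exact (ModExt.congrRight N (exteriorPower.zeroEquiv A M') l).injective.subsingleton
  | succ n ih =>
    obtain ⟨j, hj, hinj, hex⟩ := exists_wedge_lift hq hw
      (ker_wedge_eq_wedgeRange_of_projective hrs hreg (n := n) (by lia))
    exact ModExt.subsingleton_right_of_exact hinj (exteriorPower.map_surjective hq) hex l
      (subsingleton_modExt_of_projective N hds hN (n + 1) (by lia)) (ih (by lia) (by lia))

include hq hw hrs hreg hds hN in
-- At the critical total degree each connecting map is still injective; it is also onto once j
-- induces zero on Ext^{l+1}. For n > 0 the target vanishes because l + 1 is below the length of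
-- `ds`. For n = 0 it need not, and `hwN` is what makes the map zero.
theorem nonempty_modExt_equiv_of_isWeaklyRegular
    (hwN : ∃ (t : ℕ) (a : Fin t → A) (v : Fin t → M), w = ∑ k, a k • v k ∧
      ∀ k, ∀ n : N, a k • n = 0)
    {n l : ℕ} (hn : n ≤ rs.length) (hl : l + n = ds.length) :
    Nonempty (ModExt A N (⋀[A]^n M') l ≃ₗ[A] ModExt A N A ds.length) := by
  induction n generalizing l with
  | zero =>
    obtain rfl : l = ds.length := hl
    exact ⟨ModExt.congrRight N (exteriorPower.zeroEquiv A M') _⟩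
  | succ n ih =>
    obtain ⟨j, hj, hinj, hex⟩ := exists_wedge_lift hq hw
      (ker_wedge_eq_wedgeRange_of_projective hrs hreg (n := n) (by lia))
    have hzero : ∀ x, ModExt.postcomp N j (l + 1) x = 0 := fun x ↦ by
      cases n with
      | succ n =>
        have := subsingleton_modExt_of_projective (M := M) N hds hN (n + 2) (l := l + 1) (by lia)
        exact Subsingleton.elim _ _
      | zero =>
        obtain ⟨t, a, v, rfl, ha⟩ := hwN
        let e := (exteriorPower.zeroEquiv A M' ≪≫ₗ (exteriorPower.zeroEquiv A M).symm)
        -- In degree 0, j is 1 ↦ w up to the identifications with A, so it is a combination of maps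
        -- with coefficients that annihilate N.
        have h1 : j = ∑ k, a k • (wedge (v k) 0 ∘ₗ e.toLinearMap) := by
          have h2 : exteriorPower.map 0 q ∘ₗ e.toLinearMap = LinearMap.id := by
            have := exteriorPower.zeroEquiv_naturality q
            refine LinearMap.ext fun x ↦ ?_
            apply (exteriorPower.zeroEquiv A M').injective
            have h3 := LinearMap.congr_fun this (e x)
            simpa [e] using h3
          rw [← LinearMap.comp_id j, ← h2, ← LinearMap.comp_assoc, hj, wedge_sum_smul]
          refine LinearMap.ext fun x ↦ ?_
          simp [LinearMap.sum_apply]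
        rw [h1, ModExt.postcomp_sum_smul]
        exact Finset.sum_eq_zero fun k _ ↦ ModExt.smul_eq_zero (ha k) _ _
    obtain ⟨e⟩ := ih (l := l + 1) (by lia) (by lia)
    refine ⟨LinearEquiv.ofBijective
      (ModExt.connecting N hinj (exteriorPower.map_surjective hq) hex l) ⟨?_, fun x ↦ ?_⟩ ≪≫ₗ e⟩
    · exact ModExt.connecting_injective _ _ _ _
        (subsingleton_modExt_of_projective N hds hN (n + 1) (by lia))
    · exact ModExt.exists_connecting_eq _ _ _ _ _ (hzero x)

end

end exteriorPower

end WedgeExactSequences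

/-! ### Differentials of a hypersurface and the main theorem. -/

section HypersurfaceDifferentials

open RingTheory.Sequence KaehlerDifferential
open scoped TensorProduct

variable (k : Type v) [Field k] {R : Type u} [CommRing R] [Algebra k R] (f : R)

/-- The conormal sequence of a hypersurface. -/
theorem ker_mapBaseChange_eq_span_conormalDifferential :
    LinearMap.ker (mapBaseChange k R (R ⧸ Ideal.span {f})) =
      (R ⧸ Ideal.span {f}) ∙ conormalDifferential k f := by
  have hex := exact_kerCotangentToTensor_mapBaseChange k R (R ⧸ Ideal.span {f})
    Ideal.Quotient.mk_surjective
  have hker : RingHom.ker (algebraMap R (R ⧸ Ideal.span {f})) = Ideal.span {f} := Ideal.mk_ker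
  ext x
  rw [LinearMap.mem_ker, hex x, Submodule.mem_span_singleton]
  constructor
  · rintro ⟨y, rfl⟩
    obtain ⟨⟨y, hy⟩, rfl⟩ := Ideal.toCotangent_surjective _ y
    obtain ⟨a, rfl⟩ := Ideal.mem_span_singleton'.mp (hker ▸ hy)
    refine ⟨algebraMap R _ a, ?_⟩
    rw [kerCotangentToTensor_toCotangent, Derivation.leibniz, TensorProduct.tmul_add,
      ← TensorProduct.smul_tmul f, Algebra.smul_def f, Ideal.Quotient.algebraMap_eq,
      Ideal.Quotient.eq_zero_iff_mem.mpr (Ideal.mem_span_singleton_self f), zero_mul,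
      TensorProduct.zero_tmul, add_zero, TensorProduct.tmul_smul, conormalDifferential,
      ← Ideal.Quotient.algebraMap_eq, algebraMap_smul]
  · rintro ⟨a, rfl⟩
    obtain ⟨a, rfl⟩ := Ideal.Quotient.mk_surjective a
    have hf : f ∈ RingHom.ker (algebraMap R (R ⧸ Ideal.span {f})) :=
      by rw [hker]; exact Ideal.mem_span_singleton_self f
    refine ⟨a • Ideal.toCotangent _ ⟨f, hf⟩, ?_⟩
    rw [map_smul, kerCotangentToTensor_toCotangent, conormalDifferential,
      ← Ideal.Quotient.algebraMap_eq, algebraMap_smul]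

variable {f}

/-- The Jacobian ideal of a hypersurface whose singular locus has codimension at least `n` contains
a regular sequence of length `n`. -/
theorem exists_isWeaklyRegular_jacobianIdeal [PerfectField k] [Algebra.Smooth k R]
    (hf : f ∈ nonZeroDivisors R) (n : ℕ) (hn : (n : ℕ∞) ≤ codimSing (R ⧸ Ideal.span {f})) :
    ∃ rs : List (R ⧸ Ideal.span {f}),
      (∀ r ∈ rs, ∃ φ : Module.Dual (R ⧸ Ideal.span {f}) ((R ⧸ Ideal.span {f}) ⊗[R] Ω[R⁄k]),
        φ (conormalDifferential k f) = r) ∧ rs.length = n ∧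
      IsWeaklyRegular (R ⧸ Ideal.span {f}) rs := by
  have := IsRegularRing.of_smooth k R
  obtain ⟨rs, h1, h2, h3⟩ := exists_isWeaklyRegular_quotient hf (jacobianIdeal k f) n
    -- A prime containing the Jacobian ideal is a singular point, so its height is at least the
    -- codimension.
    fun p hp hle ↦ hn.trans <| iInf₂_le (⟨p, hp⟩ : PrimeSpectrum _) fun hreg ↦
      not_jacobianIdeal_le_of_isRegularLocalRing k hf p hreg hle
  exact ⟨rs, h1, h2, h3⟩

/-- A dual basis of the projective module expands df; each coefficient is the value of a linear form
at df. At a singular maximal ideal m these coefficients therefore kill A/m. -/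
lemma exists_conormalDifferential_eq_sum [Algebra.Smooth k R] :
    ∃ (t : ℕ) (a : Fin t → R ⧸ Ideal.span {f})
      (v : Fin t → (R ⧸ Ideal.span {f}) ⊗[R] Ω[R⁄k]),
      conormalDifferential k f = ∑ i, a i • v i ∧ ∀ i, a i ∈ jacobianIdeal k f := by
  obtain ⟨t, b, c, -, -, hbc⟩ := Module.Finite.exists_comp_eq_id_of_projective
    (R ⧸ Ideal.span {f}) ((R ⧸ Ideal.span {f}) ⊗[R] Ω[R⁄k])
  refine ⟨t, c (conormalDifferential k f), fun i ↦ b fun j ↦ if i = j then 1 else 0, ?_,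
    fun i ↦ (mem_jacobianIdeal k).mpr ⟨LinearMap.proj i ∘ₗ c, rfl⟩⟩
  rw [← LinearMap.pi_apply_eq_sum_univ b, ← LinearMap.comp_apply, hbc, LinearMap.id_apply]

end HypersurfaceDifferentials

theorem proposition2p4 {k : Type v} [Field k] [PerfectField k]
    {R : Type u} [CommRing R] [Algebra k R] [Algebra.Smooth k R]
    (f : R) (hf : f ∈ nonZeroDivisors R)
    (hnormal : IsNormalRing (R ⧸ Ideal.span {f}))
    (d : ℕ) (hd : HasPureDim (R ⧸ Ideal.span {f}) d) :
    (∀ (m : Ideal (R ⧸ Ideal.span {f})) [hm : m.IsMaximal],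
      (⟨m, hm.isPrime⟩ : PrimeSpectrum (R ⧸ Ideal.span {f})) ∈
        singularLocus (R ⧸ Ideal.span {f}) →
      ∀ j : ℕ, (j : ℕ∞) ≤ codimSing (R ⧸ Ideal.span {f}) →
        (∀ i : ℕ, i + j < d →
          Subsingleton (LocalCoh m i (KaehlerForms k (R ⧸ Ideal.span {f}) j))) ∧
        (∀ i : ℕ, i + j = d →
          Nonempty (socle m (LocalCoh m i (KaehlerForms k (R ⧸ Ideal.span {f}) j))
              ≃ₗ[R ⧸ Ideal.span {f}] socle m (LocalCoh m d (R ⧸ Ideal.span {f}))) ∧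
          Nonempty (socle m (LocalCoh m d (R ⧸ Ideal.span {f}))
              ≃ₗ[R ⧸ Ideal.span {f}] ((R ⧸ Ideal.span {f}) ⧸ m)))) ∧
    (∀ j : ℕ, (j : ℕ∞) + 2 ≤ codimSing (R ⧸ Ideal.span {f}) →
      Module.IsReflexive (R ⧸ Ideal.span {f}) (KaehlerForms k (R ⧸ Ideal.span {f}) j)) := by
  have := IsRegularRing.of_smooth k R
  have hq := KaehlerDifferential.mapBaseChange_surjective k R (R ⧸ Ideal.span {f}) Ideal.Quotient.mk_surjective
  have hw := ker_mapBaseChange_eq_span_conormalDifferential k f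
  refine ⟨fun m hm hsing j hj ↦ ?_, fun j hj ↦ ?_⟩
  · have hheight : m.height = d := by
      have h1 := hd m
      rw [IsLocalization.AtPrime.ringKrullDim_eq_height m] at h1
      exact_mod_cast h1
    obtain ⟨ds, hdm, rfl, hds⟩ := exists_isWeaklyRegular_quotient hf m d fun p hp hle ↦ by
      rw [← hm.eq_of_le hp.ne_top hle, hheight]
    -- The sequence in the Jacobian ideal is taken of length exactly j, which suffices as division
    -- is used only in degrees below j.
    obtain ⟨rs, hrs, rfl, hreg⟩ := exists_isWeaklyRegular_jacobianIdeal k hf j hj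
    have hkill : ∀ a ∈ m, ∀ x : (R ⧸ Ideal.span {f}) ⧸ m, a • x = 0 := fun a ha x ↦ by
      induction x using Submodule.Quotient.induction_on with | _ x
      rw [← Submodule.Quotient.mk_smul, Submodule.Quotient.mk_eq_zero]
      exact m.mul_mem_right x ha
    have hvan {i : ℕ} (hi : i + rs.length < ds.length) :=
      exteriorPower.subsingleton_modExt_of_isWeaklyRegular hq hw hrs hreg
        ((R ⧸ Ideal.span {f}) ⧸ m) hds (fun r hr ↦ hkill r (hdm r hr)) le_rfl hi
    refine ⟨fun i hi ↦ subsingleton_localCoh m i _ (hvan hi), fun i hi ↦ ?_⟩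
    obtain ⟨e1⟩ := nonempty_socle_localCoh_equiv m i
      (KaehlerForms k (R ⧸ Ideal.span {f}) rs.length) fun l hl ↦ hvan (by lia)
    obtain ⟨e2⟩ := nonempty_socle_localCoh_equiv m ds.length (R ⧸ Ideal.span {f}) fun l hl ↦
      ModExt.subsingleton_of_isWeaklyRegular hds (fun r hr ↦ hkill r (hdm r hr)) l hl
    obtain ⟨t, a, v, hav, ha⟩ := exists_conormalDifferential_eq_sum k (f := f)
    obtain ⟨e3⟩ := exteriorPower.nonempty_modExt_equiv_of_isWeaklyRegular hq hw hrs hreg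
      ((R ⧸ Ideal.span {f}) ⧸ m) hds (fun r hr ↦ hkill r (hdm r hr))
      -- This is where m must be a singular point: the Jacobian ideal is contained in m.
      ⟨t, a, v, hav, fun i ↦ hkill _ (jacobianIdeal_le_of_not_isRegularLocalRing k m hsing (ha i))⟩
      le_rfl hi
    obtain ⟨e4⟩ := nonempty_modExt_quotient_self_equiv hf m ds.length hheight
    exact ⟨⟨e1 ≪≫ₗ e3 ≪≫ₗ e2.symm⟩, ⟨e2 ≪≫ₗ e4⟩⟩
  · obtain ⟨rs, hrs, hlen, hreg⟩ := exists_isWeaklyRegular_jacobianIdeal k hf (j + 2)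
      (by exact_mod_cast hj)
    exact exteriorPower.isReflexive_of_isWeaklyRegular hq hw hrs hreg hlen.ge
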